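/- **Theorem (NPMLE consistency).** Let $q,m$ be fixed positive integers and let $R:t\mapsto\{R_t^{(i)}\}_{i=1}^m$ assign to each $t\in\mathbb{R}^q$ a partition of $\mathbb{R}$ into $m$ Borel sets (possibly empty). Let $\mathcal{Y}\subset\mathbb{R}$, let $(T_j,Y_j)_{j\ge 1}$ be i.i.d. pairs with values in $\mathbb{R}^q\times\mathbb{R}$ such that $T_j$ is independent of $Y_j$ and $Y_j\in\mathcal{Y}$ almost surely, and let $F_Y$ be the distribution function of $Y_j$. Write $F(r)$ for the probability of a Borel set $r$ under a (right-continuous) distribution function $F$. Assume that $F_Y$ is continuous and that the following two conditions hold. *Resolvability.* The law of $T_1$ has a density with respect to Lebesgue measure on $\mathbb{R}^q$, and every $y\in\overline{\mathcal{Y}}$ has an open neighborhood $N(y)\subset\mathbb{R}$ such that for all $y_a,y_b\in N(y)$ there are $t,t'$ in the support of the law of $T_1$ and $k,\ell\in\{1,\dots,m\}$ with $(y_a,y_b]\cap R_t^{(k)}=\emptyset$ and $(y_a,y_b]\cup R_t^{(k)}=R_{t'}^{(\ell)}$. *Monotonicity.* For every distribution function $F$ on $\mathbb{R}$: (a) for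 all $j\in\{1,\dots,q\}$ and $i\in\{1,\dots,m\}$, with the entries $t^{(j')}$, $j'\ne j$, held fixed, $F(R_t^{(i)})$ is either non-decreasing or non-increasing in $t^{(j)}$; (b) there are functions $G^{(1)},\dots,G^{(q)}$, non-decreasing, continuous and bounded on $[0,1]$, such that for all $j$, all $i$, and all $t_a,t_b\in\mathbb{R}^q$ differing only in the $j$-th entry, $$|F(R_{t_b}^{(i)})-F(R_{t_a}^{(i)})|\le |G^{(j)}(F(t_b^{(j)}))-G^{(j)}(F(t_a^{(j)}))|.$$ For each $n\ge1$ let $\hat F_n$ be a nonparametric maximum likelihood estimator based on the range data, that is, almost surely $\hat F_n$ is a maximizer of $$\psi_n(F)=\frac1n\sum_{j=1}^n\sum_{i=1}^m \mathbf{1}\{Y_j\in R_{T_j}^{(i)}\}\,\log F\bigl(R_{T_j}^{(i)}\bigr)\in[-\infty,0]$$ over all right-continuous distribution functions $F$ on $\mathcal{Y}$ (those giving probability one to $\mathcal{Y}$), with the conventions $\log 0=-\infty$ and $0\cdot(-\infty)=0$. Then $$\sup_{y\in\mathcal{Y}}|\hat F_n(y)-F_Y(y)|\longrightarrow 0\quad\text{almost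 surely as } n\to\infty .$$ -/

import Mathlib

open MeasureTheory ProbabilityTheory Filter Topology
open scoped ENNReal

noncomputable section

namespace RangePrivacy

/-- A map `t ↦ (R_t^(1), …, R_t^(m))` sending each `t ∈ ℝ^q` to a partition of the real line into
`m` (possibly empty) Borel ranges. -/
structure RangeMap (q m : ℕ) where
  range : (Fin q → ℝ) → Fin m → Set ℝ
  measurableSet_range : ∀ t i, MeasurableSet (range t i)
  disjoint_range : ∀ t i j, i ≠ j → Disjoint (range t i) (range t j)
  iUnion_range : ∀ t, ⋃ i, range t i = Set.univ

variable {q m : ℕ}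

/-- The data set `(T_j)_j`, `(Y_j)_j` of size `n` enters the log-likelihood
`ψ(F) = (1/n) ∑_j ∑_i B_j^(i) log F(R_{T_j}^(i))` only through `T_j` and the indicators
`B_j^(i) = 1{Y_j ∈ R_{T_j}^(i)}`. A right-continuous distribution function `F` is given as the
probability measure on `ℝ` that it induces. The values are extended real with `log 0 = -∞`, and a
term whose indicator is `0` contributes `0`. -/
def logLikelihood (R : RangeMap q m) {n : ℕ} (T : Fin n → Fin q → ℝ) (Y : Fin n → ℝ)
    (F : ProbabilityMeasure ℝ) : EReal :=
  (((n : ℝ)⁻¹ : ℝ) : EReal) *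
    ∑ j, ∑ i, (R.range (T j) i).indicator
      (fun _ => ENNReal.log ((F : Measure ℝ) (R.range (T j) i))) (Y j)

/-- `F` is a distribution function on `𝒴`: it gives mass one to `𝒴`. -/
def IsDistributionOn (𝒴 : Set ℝ) (F : ProbabilityMeasure ℝ) : Prop :=
  ∀ᵐ y ∂(F : Measure ℝ), y ∈ 𝒴

/-- `Fhat` maximizes the log-likelihood over all distribution functions on `𝒴`. -/
def IsNPMLE (𝒴 : Set ℝ) (R : RangeMap q m) {n : ℕ} (T : Fin n → Fin q → ℝ) (Y : Fin n → ℝ)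
    (Fhat : ProbabilityMeasure ℝ) : Prop :=
  IsDistributionOn 𝒴 Fhat ∧
    ∀ F : ProbabilityMeasure ℝ, IsDistributionOn 𝒴 F →
      logLikelihood R T Y F ≤ logLikelihood R T Y Fhat

/-- Resolvability, for `T` with law `PT`: `T` has a Lebesgue density, and around each point of the
closure of `𝒴` every small interval `(a, b]` is the difference of two feasible ranges. -/
def Resolvability (𝒴 : Set ℝ) (R : RangeMap q m) (PT : Measure (Fin q → ℝ)) : Prop :=
  (∃ p : (Fin q → ℝ) → ℝ≥0∞, Measurable p ∧ PT = volume.withDensity p) ∧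
    ∀ y ∈ closure 𝒴, ∃ N : Set ℝ, IsOpen N ∧ y ∈ N ∧ ∀ a ∈ N, ∀ b ∈ N,
      ∃ t ∈ PT.support, ∃ t' ∈ PT.support, ∃ k l : Fin m,
        Set.Ioc a b ∩ R.range t k = ∅ ∧ Set.Ioc a b ∪ R.range t k = R.range t' l

/-- Monotonicity: for every distribution function `F`, each `F(R_t^(i))` is monotone in each single
entry of `t`, and its increments are controlled by those of `G^(j) ∘ F`. -/
def Monotonicity (R : RangeMap q m) : Prop :=
  ∀ F : ProbabilityMeasure ℝ,
    (∀ (j : Fin q) (i : Fin m) (t : Fin q → ℝ),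
      Monotone (fun s => (F : Measure ℝ).real (R.range (Function.update t j s) i)) ∨
        Antitone (fun s => (F : Measure ℝ).real (R.range (Function.update t j s) i))) ∧
    ∃ G : Fin q → ℝ → ℝ,
      (∀ j, MonotoneOn (G j) (Set.Icc 0 1) ∧ ContinuousOn (G j) (Set.Icc 0 1) ∧
        Bornology.IsBounded (G j '' Set.Icc 0 1)) ∧
      ∀ (j : Fin q) (i : Fin m) (ta tb : Fin q → ℝ), (∀ j', j' ≠ j → ta j' = tb j') →
        |(F : Measure ℝ).real (R.range tb i) - (F : Measure ℝ).real (R.range ta i)| ≤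
          |G j (cdf (F : Measure ℝ) (tb j)) - G j (cdf (F : Measure ℝ) (ta j))|

end RangePrivacy

end

namespace RangePrivacy

/-! Testing `Monotonicity` on Dirac masses shows that membership of `y` in `R_t^(i)` depends on `t`
only through the comparisons `y ≤ t^(j)`. Hence, for every law `F`, `F(R_t^(i))` changes by at most
the `F`-mass lying between the old and new coordinates (`Monotonicity.abs_real_sub_le`), a bound
that survives setwise limits.

Moving a maximizer slightly towards `F_Y` cannot raise the likelihood, so the empirical mean of
`F_Y(R) / F̂_n(R)` over the observed ranges is at most 1 (`IsNPMLE.sum_div_le`). Fix an outcome in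
an almost sure event and let `M` be the setwise limit of `F̂_n` along an ultrafilter; it is only
known to be finitely additive. Freezing the denominators on finitely many quantile cells of `T`
leaves finitely many laws of large numbers at each resolution, and in the limit the mean of `∑
F_Y(R_t^(i))² / (M(R_t^(i)) + δ)`, with `M` evaluated at cell points, is at most 1 up to a small
error (`integral_inv_mul_sq_le`). A chi-square inequality (`sum_sq_le`) then forces `M(R_t^(i)) =
F_Y(R_t^(i))` for almost every `t` (`limit_range_ae_eq`).

Resolvability uses points of the support, where equality may fail because `x ↦ M((-∞, x])` may jump.
The error there takes only countably many values, as jumps are countable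
(`countable_image_sub_support`). So the increments of `M((-∞, x]) - F_Y(x)` over short intervals lie
in a countable set; this difference can only jump upwards, and a decrease would sweep through
uncountably many values (`sub_le_sub_of_countable`). It is therefore nondecreasing, and its
behaviour at `±∞` makes it zero (`limit_Iic_eq_cdf`). As this holds for every ultrafilter, `F̂_n`
converges pointwise, and uniformly because `F_Y` is continuous. -/

variable {q m : ℕ}

/-! ### Dependence of the ranges on their parameter -/

/-- A function of finitely many real coordinates that is unchanged by each admissible change of a
single coordinate is unchanged by any admissible change. -/
theorem eq_of_forall_update_eq {ι α β : Type*} [Fintype ι] [DecidableEq ι] (f : (ι → α) → β)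
    (r : ι → α → α → Prop)
    (h : ∀ (t : ι → α) (j : ι) (a : α), r j a (t j) → f (Function.update t j a) = f t)
    (s t : ι → α) (hst : ∀ j, r j (s j) (t j)) : f s = f t := by
  have key : ∀ A : Finset ι, f (A.piecewise s t) = f t := by
    intro A
    induction A using Finset.induction_on with
    | empty => simp
    | insert j A hj ih =>
      rw [Finset.piecewise_insert, h, ih]
      rw [Finset.piecewise_eq_of_notMem _ _ _ hj]
      exact hst j
  simpa using key Finset.univ

theorem cdf_dirac_eq_of_le_iff {y a b : ℝ} (h : y ≤ a ↔ y ≤ b) :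
    cdf (Measure.dirac y) a = cdf (Measure.dirac y) b := by
  rw [cdf_eq_real, cdf_eq_real, measureReal_def, measureReal_def,
    Measure.dirac_apply' _ measurableSet_Iic, Measure.dirac_apply' _ measurableSet_Iic]
  simp [Set.indicator, h]

/-- Whether `y` lies in `R_t^(i)` depends on `t` only through the comparisons `y ≤ t^(j)`. -/
theorem Monotonicity.mem_range_iff {R : RangeMap q m} (hR : Monotonicity R) {y : ℝ}
    {s t : Fin q → ℝ} (h : ∀ j, y ≤ s j ↔ y ≤ t j) (i : Fin m) :
    y ∈ R.range s i ↔ y ∈ R.range t i := by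
  -- For the Dirac mass at `y`, range probabilities are 0 or 1 and the distribution function at
  -- `t^(j)` sees only whether `y ≤ t^(j)`.
  obtain ⟨-, G, -, hG⟩ := hR ⟨Measure.dirac y, inferInstance⟩
  rw [← eq_iff_iff]
  refine eq_of_forall_update_eq (fun t => y ∈ R.range t i) (fun _ a b => y ≤ a ↔ y ≤ b) ?_ s t h
  intro t j a ha
  have h1 := hG j i t (Function.update t j a) (fun j' hj' => by simp [hj'])
  simp only [ProbabilityMeasure.coe_mk, Function.update_self, cdf_dirac_eq_of_le_iff ha, sub_self,
    abs_zero] at h1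
  have h2 := abs_nonpos_iff.1 h1
  simp only [measureReal_def, Measure.dirac_apply' _ (R.measurableSet_range _ _)] at h2
  by_cases h3 : y ∈ R.range (Function.update t j a) i <;> by_cases h4 : y ∈ R.range t i <;>
    simp_all

theorem real_uIoc (F : Measure ℝ) [IsProbabilityMeasure F] (a b : ℝ) :
    F.real (Set.uIoc a b) = |cdf F b - cdf F a| := by
  have key : ∀ a b : ℝ, a ≤ b → F.real (Set.Ioc a b) = cdf F b - cdf F a := by
    intro a b hab
    rw [cdf_eq_real, cdf_eq_real, ← Set.Iic_sdiff_Iic,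
      measureReal_sdiff (Set.Iic_subset_Iic.2 hab) measurableSet_Iic]
  rcases le_total a b with hab | hab
  · rw [Set.uIoc_of_le hab, key a b hab, abs_of_nonneg (sub_nonneg.2 (monotone_cdf F hab))]
  · rw [Set.uIoc_of_ge hab, key b a hab, abs_sub_comm,
      abs_of_nonneg (sub_nonneg.2 (monotone_cdf F hab))]

/-- If `y` lies in no interval between `s j` and `t j`, then `s` and `t` compare with `y` in the
same way. -/
theorem Monotonicity.range_diff_subset {R : RangeMap q m} (hR : Monotonicity R)
    (s t : Fin q → ℝ) (i : Fin m) :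
    R.range s i \ R.range t i ⊆ ⋃ j, Set.uIoc (s j) (t j) := by
  rintro y ⟨hs, ht⟩
  by_contra hy
  refine ht ((hR.mem_range_iff (fun j => ?_) i).1 hs)
  simp only [Set.mem_iUnion, not_exists, Set.mem_uIoc, not_or, not_and, not_le] at hy
  constructor <;> intro h <;> by_contra h' <;> push Not at h'
  · exact absurd h (not_le.2 ((hy j).2 h'))
  · exact absurd h (not_le.2 ((hy j).1 h'))

theorem Monotonicity.abs_real_sub_le {R : RangeMap q m} (hR : Monotonicity R)
    (F : Measure ℝ) [IsProbabilityMeasure F] (s t : Fin q → ℝ) (i : Fin m) :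
    |F.real (R.range s i) - F.real (R.range t i)| ≤ ∑ j, F.real (Set.uIoc (s j) (t j)) := by
  have key : ∀ s t : Fin q → ℝ, F.real (R.range s i) - F.real (R.range t i) ≤
      ∑ j, F.real (Set.uIoc (s j) (t j)) := by
    intro s t
    calc F.real (R.range s i) - F.real (R.range t i)
        ≤ F.real (R.range s i \ R.range t i) := le_measureReal_sdiff
      _ ≤ F.real (⋃ j, Set.uIoc (s j) (t j)) := measureReal_mono (hR.range_diff_subset s t i)
      _ ≤ _ := measureReal_iUnion_fintype_le _
  refine abs_sub_le_iff.2 ⟨key s t, (key t s).trans_eq ?_⟩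
  simp_rw [Set.uIoc_comm]

theorem Monotonicity.abs_real_sub_le_cdf {R : RangeMap q m} (hR : Monotonicity R)
    (F : Measure ℝ) [IsProbabilityMeasure F] (s t : Fin q → ℝ) (i : Fin m) :
    |F.real (R.range s i) - F.real (R.range t i)| ≤ ∑ j, |cdf F (s j) - cdf F (t j)| := by
  refine (hR.abs_real_sub_le F s t i).trans_eq (Finset.sum_congr rfl fun j _ => ?_)
  rw [real_uIoc, abs_sub_comm]

/-- The relation `y ∈ R_t^(i)` is jointly measurable in `(t, y)`. -/
theorem Monotonicity.measurableSet_mem_range {R : RangeMap q m} (hR : Monotonicity R) (i : Fin m) :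
    MeasurableSet {x : (Fin q → ℝ) × ℝ | x.2 ∈ R.range x.1 i} := by
  -- Rounding up to a grid makes the parameter discrete. It preserves `y ≤ t^(j)`, and it preserves
  -- `t^(j) < y` once the grid is fine, so membership is eventually unchanged.
  let rnd : ℕ → ℝ → ℤ := fun N x => ⌈x * (N + 1)⌉
  let D : ℕ → Set ((Fin q → ℝ) × ℝ) := fun N =>
    {x | x.2 ∈ R.range (fun j => (rnd N (x.1 j) : ℝ) / (N + 1)) i}
  have hD : ∀ N, MeasurableSet (D N) := by
    intro N
    have h1 : D N = ⋃ z : Fin q → ℤ, {x | (fun j => rnd N (x.1 j)) = z} ∩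
        {x | x.2 ∈ R.range (fun j => (z j : ℝ) / (N + 1)) i} := by
      ext x
      simp [D]
    rw [h1]
    refine MeasurableSet.iUnion fun z => MeasurableSet.inter ?_ ?_
    · have : Measurable (fun x : (Fin q → ℝ) × ℝ => fun j => rnd N (x.1 j)) := by
        refine measurable_pi_lambda _ fun j => Int.measurable_ceil.comp ?_
        fun_prop
      exact this (measurableSet_singleton z)
    · exact measurable_snd (R.measurableSet_range _ i)
  have hlim : {x : (Fin q → ℝ) × ℝ | x.2 ∈ R.range x.1 i} = ⋃ N₀, ⋂ N ≥ N₀, D N := by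
    have hev : ∀ x : (Fin q → ℝ) × ℝ, ∀ᶠ N in atTop, (x ∈ D N ↔ x.2 ∈ R.range x.1 i) := by
      intro x
      have : ∀ j, ∀ᶠ N : ℕ in atTop,
          (x.2 ≤ (rnd N (x.1 j) : ℝ) / (N + 1) ↔ x.2 ≤ x.1 j) := by
        intro j
        have hle : ∀ N : ℕ, x.1 j ≤ (rnd N (x.1 j) : ℝ) / (N + 1) := fun N => by
          rw [le_div_iff₀ (by positivity)]
          exact Int.le_ceil _
        rcases le_or_gt x.2 (x.1 j) with h | h
        · exact Eventually.of_forall fun N => ⟨fun _ => h, fun _ => h.trans (hle N)⟩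
        · have ht := tendsto_one_div_add_atTop_nhds_zero_nat (𝕜 := ℝ)
          filter_upwards [ht.eventually_lt_const (sub_pos.2 h)] with N hN
          refine ⟨fun h' => ?_, fun h' => absurd h (not_lt.2 h')⟩
          exfalso
          have h1 : (rnd N (x.1 j) : ℝ) < x.1 j * (N + 1) + 1 := Int.ceil_lt_add_one _
          have h2 : (rnd N (x.1 j) : ℝ) / (N + 1) < x.1 j + 1 / (N + 1) := by
            rw [div_lt_iff₀ (by positivity)]
            have : (x.1 j + 1 / ((N : ℝ) + 1)) * (N + 1) = x.1 j * (N + 1) + 1 := by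
              field_simp
            rw [this]
            exact h1
          linarith
      filter_upwards [eventually_all.2 this] with N hN
      exact hR.mem_range_iff hN i
    ext x
    simp only [Set.mem_ofPred_eq, Set.mem_iUnion, Set.mem_iInter]
    constructor
    · intro hx
      obtain ⟨N₀, h⟩ := eventually_atTop.1 (hev x)
      exact ⟨N₀, fun N hN => (h N hN).2 hx⟩
    · rintro ⟨N₀, h⟩
      obtain ⟨N₁, h'⟩ := eventually_atTop.1 (hev x)
      exact (h' (max N₀ N₁) (le_max_right _ _)).1 (h _ (le_max_left _ _))
  rw [hlim]
  exact MeasurableSet.iUnion fun N₀ => MeasurableSet.iInter fun N => MeasurableSet.iInter fun _ =>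
    hD N

theorem Monotonicity.measurable_real_range {R : RangeMap q m} (hR : Monotonicity R)
    (F : Measure ℝ) [IsProbabilityMeasure F] (i : Fin m) :
    Measurable fun t => F.real (R.range t i) :=
  (measurable_measure_prodMk_left (hR.measurableSet_mem_range i)).ennreal_toReal

theorem Monotonicity.continuous_real_range {R : RangeMap q m} (hR : Monotonicity R)
    (F : Measure ℝ) [IsProbabilityMeasure F] (hF : Continuous (cdf F)) (i : Fin m) :
    Continuous fun t => F.real (R.range t i) := by
  refine continuous_iff_continuousAt.2 fun t => ?_
  rw [ContinuousAt, tendsto_iff_dist_tendsto_zero]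
  refine squeeze_zero (fun _ => dist_nonneg)
    (fun s => (Real.dist_eq _ _).trans_le (hR.abs_real_sub_le_cdf F s t i)) ?_
  have : Continuous fun s : Fin q → ℝ => ∑ j, |cdf F (s j) - cdf F (t j)| := by fun_prop
  simpa using this.tendsto t

theorem RangeMap.sum_real_range (R : RangeMap q m) (F : Measure ℝ) [IsProbabilityMeasure F]
    (t : Fin q → ℝ) : ∑ i, F.real (R.range t i) = 1 := by
  rw [← measureReal_biUnion_finset (fun i _ j _ hij => R.disjoint_range t i j hij)
    (fun i _ => R.measurableSet_range t i)]
  simp [R.iUnion_range t]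

theorem RangeMap.existsUnique_mem_range (R : RangeMap q m) (t : Fin q → ℝ) (y : ℝ) :
    ∃ i, y ∈ R.range t i ∧ ∀ j, y ∈ R.range t j → j = i := by
  have : y ∈ ⋃ i, R.range t i := by simp [R.iUnion_range t]
  obtain ⟨i, hi⟩ := Set.mem_iUnion.1 this
  refine ⟨i, hi, fun j hj => ?_⟩
  by_contra hne
  exact Set.disjoint_left.1 (R.disjoint_range t j i hne) hj hi

theorem RangeMap.sum_indicator_range (R : RangeMap q m) {M : Type*} [AddCommMonoid M]
    (t : Fin q → ℝ) {y : ℝ} {i : Fin m} (hi : y ∈ R.range t i) (f : Fin m → M) :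
    ∑ k, (R.range t k).indicator (fun _ => f k) y = f i := by
  rw [Finset.sum_eq_single i]
  · simp [hi]
  · intro k _ hk
    exact Set.indicator_of_notMem (fun h => Set.disjoint_left.1 (R.disjoint_range t k i hk) h hi) _
  · simp

/-- The effect on `F(R_t^(i))` of moving some coordinates of `t` slightly is determined by the
order relations between the moved coordinates and the others. -/
theorem Monotonicity.real_piecewise_sub_eq {R : RangeMap q m} (hR : Monotonicity R)
    (F : Measure ℝ) [IsProbabilityMeasure F] (J : Finset (Fin q)) (s t u : Fin q → ℝ)
    (hst : ∀ j ∈ J, s j = t j)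
    (ht : ∀ j ∈ J, ∀ k ∉ J, ∀ y ∈ Set.uIoc (t j) (u j), (y ≤ s k ↔ y ≤ t k)) (i : Fin m) :
    F.real (R.range (J.piecewise u s) i) - F.real (R.range s i) =
      F.real (R.range (J.piecewise u t) i) - F.real (R.range t i) := by
  have hint : ∀ t : Fin q → ℝ, F.real (R.range t i) = ∫ y, (R.range t i).indicator 1 y ∂F :=
    fun t => (integral_indicator_one (R.measurableSet_range t i)).symm
  have hI : ∀ t : Fin q → ℝ, Integrable ((R.range t i).indicator (1 : ℝ → ℝ)) F := fun t =>
    (integrable_const (1 : ℝ)).indicator (R.measurableSet_range t i)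
  rw [hint, hint, hint, hint, ← integral_sub (hI _) (hI _), ← integral_sub (hI _) (hI _)]
  congr 1
  ext y
  have hind : ∀ A B : Set ℝ, (y ∈ A ↔ y ∈ B) → A.indicator (1 : ℝ → ℝ) y = B.indicator 1 y := by
    intro A B h
    by_cases hA : y ∈ A
    · rw [Set.indicator_of_mem hA, Set.indicator_of_mem (h.1 hA)]
    · rw [Set.indicator_of_notMem hA, Set.indicator_of_notMem (fun hB => hA (h.2 hB))]
  -- A point crossed by a moving coordinate compares alike with `s` and `t`, before and after the
  -- move. For any other point the move does not affect membership, and both differences vanish.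
  by_cases hy : ∃ j ∈ J, y ∈ Set.uIoc (t j) (u j)
  · obtain ⟨j, hj, hy⟩ := hy
    have h1 : y ∈ R.range s i ↔ y ∈ R.range t i := by
      refine hR.mem_range_iff (fun k => ?_) i
      by_cases hk : k ∈ J
      · rw [hst k hk]
      · exact ht j hj k hk y hy
    have h2 : y ∈ R.range (J.piecewise u s) i ↔ y ∈ R.range (J.piecewise u t) i := by
      refine hR.mem_range_iff (fun k => ?_) i
      by_cases hk : k ∈ J
      · simp [hk]
      · simpa [hk] using ht j hj k hk y hy
    rw [hind _ _ h1, hind _ _ h2]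
  · have h0 : ∀ s : Fin q → ℝ, (∀ j ∈ J, s j = t j) →
        (y ∈ R.range (J.piecewise u s) i ↔ y ∈ R.range s i) := by
      intro s hst
      refine hR.mem_range_iff (fun k => ?_) i
      by_cases hk : k ∈ J
      · have h3 : y ∉ Set.uIoc (t k) (u k) := fun h => hy ⟨k, hk, h⟩
        simp only [Set.mem_uIoc, not_or, not_and, not_le] at h3
        simp only [hk, Finset.piecewise_eq_of_mem, hst k hk]
        constructor <;> intro h <;> by_contra h' <;> push Not at h'
        · exact absurd h (not_le.2 (h3.1 h'))
        · exact absurd h (not_le.2 (h3.2 h'))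
      · simp [hk]
    rw [hind _ _ (h0 s hst), hind _ _ (h0 t fun _ _ => rfl), sub_self, sub_self]

/-! ### The log-likelihood and its first-order condition -/

theorem logLikelihood_eq_sum (R : RangeMap q m) {n : ℕ} (T : Fin n → Fin q → ℝ) (Y : Fin n → ℝ)
    (F : ProbabilityMeasure ℝ) (l : Fin n → Fin m) (hl : ∀ j, Y j ∈ R.range (T j) (l j)) :
    logLikelihood R T Y F = (((n : ℝ)⁻¹ : ℝ) : EReal) *
      ∑ j, ENNReal.log ((F : Measure ℝ) (R.range (T j) (l j))) := by
  unfold logLikelihood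
  congr 1
  exact Finset.sum_congr rfl fun j _ => R.sum_indicator_range (T j) (hl j)
    fun i => ENNReal.log ((F : Measure ℝ) (R.range (T j) i))

theorem logLikelihood_eq_coe (R : RangeMap q m) {n : ℕ} (T : Fin n → Fin q → ℝ) (Y : Fin n → ℝ)
    (F : ProbabilityMeasure ℝ) (l : Fin n → Fin m) (hl : ∀ j, Y j ∈ R.range (T j) (l j))
    (hpos : ∀ j, 0 < (F : Measure ℝ).real (R.range (T j) (l j))) :
    logLikelihood R T Y F = (((n : ℝ)⁻¹ *
      ∑ j, Real.log ((F : Measure ℝ).real (R.range (T j) (l j))) : ℝ) : EReal) := by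
  have hsum : ∀ (s : Finset (Fin n)) (f : Fin n → ℝ),
      ((∑ j ∈ s, f j : ℝ) : EReal) = ∑ j ∈ s, (f j : EReal) := by
    intro s f
    induction s using Finset.induction_on with
    | empty => simp
    | insert a s ha ih => rw [Finset.sum_insert ha, Finset.sum_insert ha, EReal.coe_add, ih]
  rw [logLikelihood_eq_sum R T Y F l hl, EReal.coe_mul, hsum]
  congr 1
  refine Finset.sum_congr rfl fun j _ => ?_
  rw [← ENNReal.log_ofReal_of_pos (hpos j), ofReal_measureReal]

theorem logLikelihood_eq_bot (R : RangeMap q m) {n : ℕ} (T : Fin n → Fin q → ℝ) (Y : Fin n → ℝ)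
    (F : ProbabilityMeasure ℝ) (l : Fin n → Fin m) (hl : ∀ j, Y j ∈ R.range (T j) (l j))
    (j : Fin n) (hj : (F : Measure ℝ) (R.range (T j) (l j)) = 0) :
    logLikelihood R T Y F = ⊥ := by
  rw [logLikelihood_eq_sum R T Y F l hl,
    ← Finset.add_sum_erase _ _ (Finset.mem_univ j), hj, ENNReal.log_zero, EReal.bot_add,
    EReal.coe_mul_bot_of_pos]
  have : 0 < n := j.pos
  positivity

/-- If `∑ log (1 + ε s_j) ≤ 0` for all small `ε`, then `∑ s_j ≤ 0`. -/
theorem sum_nonpos_of_sum_log_nonpos {ι : Type*} [Fintype ι] (s : ι → ℝ) (hs : ∀ j, -1 < s j)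
    (h : ∀ ε ∈ Set.Ioo (0 : ℝ) 1, ∑ j, Real.log (1 + ε * s j) ≤ 0) : ∑ j, s j ≤ 0 := by
  have h1 : ∀ ε ∈ Set.Ioo (0 : ℝ) 1, ∑ j, s j / (1 + ε * s j) ≤ 0 := by
    intro ε hε
    have hpos : ∀ j, 0 < 1 + ε * s j := fun j => by nlinarith [hs j, hε.1, hε.2]
    have h2 : ε * ∑ j, s j / (1 + ε * s j) ≤ 0 := by
      refine le_trans ?_ (h ε hε)
      rw [Finset.mul_sum]
      refine Finset.sum_le_sum fun j _ => ?_
      -- This is `x / (1 + x) ≤ log (1 + x)` with `x = ε * s j`.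
      refine le_trans (le_of_eq ?_) (Real.one_sub_inv_le_log_of_pos (hpos j))
      field_simp [(hpos j).ne']
      ring
    exact nonpos_of_mul_nonpos_right h2 hε.1
  have h2 : Tendsto (fun ε : ℝ => ∑ j, s j / (1 + ε * s j)) (𝓝[>] 0) (𝓝 (∑ j, s j)) := by
    have : ContinuousAt (fun ε : ℝ => ∑ j, s j / (1 + ε * s j)) 0 := by
      refine tendsto_finsetSum _ fun j _ => ?_
      have : ContinuousAt (fun ε : ℝ => s j / (1 + ε * s j)) 0 :=
        continuousAt_const.div (by fun_prop) (by simp)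
      exact this
    simpa using this.tendsto.mono_left nhdsWithin_le_nhds
  refine le_of_tendsto h2 ?_
  filter_upwards [Ioo_mem_nhdsGT (zero_lt_one (α := ℝ))] with ε hε using h1 ε hε

/-- The convex combination `(1 - ε) F + ε G` of probability measures. -/
noncomputable def mixture (F G : ProbabilityMeasure ℝ) (ε : ℝ) (hε : ε ∈ Set.Ioo (0 : ℝ) 1) :
    ProbabilityMeasure ℝ :=
  ⟨ENNReal.ofReal (1 - ε) • (F : Measure ℝ) + ENNReal.ofReal ε • (G : Measure ℝ), ⟨by
    simp only [Measure.coe_add, Measure.coe_smul, Pi.add_apply, Pi.smul_apply, measure_univ,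
      smul_eq_mul, mul_one]
    rw [← ENNReal.ofReal_add (by linarith [hε.2]) hε.1.le]
    simp⟩⟩

theorem mixture_real (F G : ProbabilityMeasure ℝ) (ε : ℝ) (hε : ε ∈ Set.Ioo (0 : ℝ) 1)
    (A : Set ℝ) : (mixture F G ε hε : Measure ℝ).real A =
      (1 - ε) * (F : Measure ℝ).real A + ε * (G : Measure ℝ).real A := by
  have h1 : 0 ≤ 1 - ε := by linarith [hε.2]
  simp only [mixture, ProbabilityMeasure.coe_mk]
  have hfin : ∀ (c : ℝ) (H : ProbabilityMeasure ℝ), (ENNReal.ofReal c • (H : Measure ℝ)) A ≠ ∞ :=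
    fun c H => ENNReal.mul_ne_top ENNReal.ofReal_ne_top (measure_ne_top _ _)
  rw [measureReal_add_apply (hfin _ _) (hfin _ _), measureReal_ennreal_smul_apply, measureReal_ennreal_smul_apply,
    ENNReal.toReal_ofReal h1, ENNReal.toReal_ofReal hε.1.le]

theorem IsDistributionOn.mixture {𝒴 : Set ℝ} {F G : ProbabilityMeasure ℝ}
    (hF : IsDistributionOn 𝒴 F) (hG : IsDistributionOn 𝒴 G) (ε : ℝ)
    (hε : ε ∈ Set.Ioo (0 : ℝ) 1) : IsDistributionOn 𝒴 (mixture F G ε hε) := by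
  unfold IsDistributionOn RangePrivacy.mixture
  simp only [ProbabilityMeasure.coe_mk]
  rw [ae_add_measure_iff]
  exact ⟨Measure.ae_smul_measure hF _, Measure.ae_smul_measure hG _⟩

/-- First-order optimality of the maximizer of the log-likelihood. -/
theorem IsNPMLE.sum_div_le {𝒴 : Set ℝ} {R : RangeMap q m} {n : ℕ} {T : Fin n → Fin q → ℝ}
    {Y : Fin n → ℝ} {Fhat : ProbabilityMeasure ℝ} (h : IsNPMLE 𝒴 R T Y Fhat)
    {F : ProbabilityMeasure ℝ} (hF : IsDistributionOn 𝒴 F) (l : Fin n → Fin m)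
    (hl : ∀ j, Y j ∈ R.range (T j) (l j))
    (hpos : ∀ j, 0 < (F : Measure ℝ).real (R.range (T j) (l j))) :
    (∀ j, 0 < (Fhat : Measure ℝ).real (R.range (T j) (l j))) ∧
      ∑ j, (F : Measure ℝ).real (R.range (T j) (l j)) /
        (Fhat : Measure ℝ).real (R.range (T j) (l j)) ≤ n := by
  have hpos' : ∀ j, 0 < (Fhat : Measure ℝ).real (R.range (T j) (l j)) := by
    intro j
    -- A null observed range would give `Fhat` likelihood `-∞`, below the finite likelihood of `F`.
    refine measureReal_nonneg.lt_of_ne' fun h0 => ?_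
    have h1 := h.2 F hF
    rw [logLikelihood_eq_bot R T Y Fhat l hl j ((measureReal_eq_zero_iff).1 h0),
      logLikelihood_eq_coe R T Y F l hl hpos, le_bot_iff] at h1
    exact EReal.coe_ne_bot _ h1
  refine ⟨hpos', ?_⟩
  set p := fun j => (F : Measure ℝ).real (R.range (T j) (l j)) with hp
  set r := fun j => (Fhat : Measure ℝ).real (R.range (T j) (l j)) with hr
  have hsum : ∑ j, (p j / r j - 1) ≤ 0 := by
    refine sum_nonpos_of_sum_log_nonpos _ (fun j => ?_) fun ε hε => ?_
    · have := div_pos (hpos j) (hpos' j)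
      linarith
    · have hmix : ∀ j, (mixture Fhat F ε hε : Measure ℝ).real (R.range (T j) (l j)) =
          r j * (1 + ε * (p j / r j - 1)) := fun j => by
        rw [mixture_real]
        have := (hpos' j).ne'
        simp only [hp, hr]
        field_simp
        ring
      have hmpos : ∀ j, 0 < (mixture Fhat F ε hε : Measure ℝ).real (R.range (T j) (l j)) := by
        intro j
        rw [mixture_real]
        have := mul_pos hε.1 (hpos j)
        have := mul_pos (sub_pos.2 hε.2) (hpos' j)
        linarith
      have h1 := h.2 _ (h.1.mixture hF ε hε)
      rw [logLikelihood_eq_coe R T Y _ l hl hmpos, logLikelihood_eq_coe R T Y _ l hl hpos',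
        EReal.coe_le_coe_iff] at h1
      rcases Nat.eq_zero_or_pos n with rfl | hn
      · simp
      have h2 := le_of_mul_le_mul_left h1 (by positivity)
      have h3 : ∀ j, Real.log ((mixture Fhat F ε hε : Measure ℝ).real (R.range (T j) (l j))) =
          Real.log (r j) + Real.log (1 + ε * (p j / r j - 1)) := by
        intro j
        have h4 := hmpos j
        rw [hmix] at h4 ⊢
        exact Real.log_mul (hpos' j).ne' (pos_of_mul_pos_right h4 (hpos' j).le).ne'
      rw [Finset.sum_congr rfl fun j _ => h3 j, Finset.sum_add_distrib] at h2
      linarith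
  rw [Finset.sum_sub_distrib] at hsum
  simp only [Finset.sum_const, Finset.card_univ, Fintype.card_fin, nsmul_eq_mul, mul_one] at hsum
  linarith

/-! ### Errors on the support -/

/-- A point of the support is the limit of a filter along which an almost sure property holds and
along which each coordinate converges strictly from one side. -/
theorem exists_filter_of_mem_support {PT : Measure (Fin q → ℝ)}
    (hH : ∀ j c, PT {t | t j = c} = 0) {A : (Fin q → ℝ) → Prop} (hA : ∀ᵐ t ∂PT, A t)
    {t : Fin q → ℝ} (ht : t ∈ PT.support) :
    ∃ (σ : Fin q → Prop) (𝒱 : Filter (Fin q → ℝ)), 𝒱.NeBot ∧ 𝒱 ≤ 𝓝 t ∧ (∀ᶠ u in 𝒱, A u) ∧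
      ∀ j, (σ j → Tendsto (fun u => u j) 𝒱 (𝓝[>] (t j))) ∧
        (¬ σ j → Tendsto (fun u => u j) 𝒱 (𝓝[<] (t j))) := by
  let G : Set (Fin q → ℝ) := {u | A u ∧ ∀ j, u j ≠ t j}
  have hG : ∀ᵐ u ∂PT, u ∈ G := by
    have h1 : ∀ j, ∀ᵐ u ∂PT, u j ≠ t j := fun j => by
      rw [ae_iff]
      simpa using hH j (t j)
    filter_upwards [hA, ae_all_iff.2 h1] with u h2 h3 using ⟨h2, h3⟩
  have hne : (𝓝[G] t).NeBot := by
    rw [← mem_closure_iff_nhdsWithin_neBot, mem_closure_iff_nhds]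
    intro U hU
    have h1 := (Measure.mem_support_iff_forall t).1 ht U hU
    by_contra hempty
    rw [Set.not_nonempty_iff_eq_empty] at hempty
    have h2 : U ⊆ Gᶜ := fun u hu hu' => by
      have : u ∈ U ∩ G := ⟨hu, hu'⟩
      rw [hempty] at this
      exact this
    exact h1.ne' (measure_mono_null h2 hG)
  -- An ultrafilter decides on which side of `t j` each coordinate lies; on `G` equality is
  -- excluded.
  let 𝒱 : Ultrafilter (Fin q → ℝ) := Ultrafilter.of (𝓝[G] t)
  have h𝒱 : (𝒱 : Filter _) ≤ 𝓝[G] t := Ultrafilter.of_le _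
  have h𝒱t : (𝒱 : Filter _) ≤ 𝓝 t := h𝒱.trans nhdsWithin_le_nhds
  have hmem : ∀ᶠ u in (𝒱 : Filter _), u ∈ G := h𝒱 self_mem_nhdsWithin
  have hcoord : ∀ j, Tendsto (fun u : Fin q → ℝ => u j) 𝒱 (𝓝 (t j)) := fun j =>
    ((continuous_apply j).tendsto t).mono_left h𝒱t
  refine ⟨fun j => ∀ᶠ u : Fin q → ℝ in (𝒱 : Filter _), t j < u j, (𝒱 : Filter (Fin q → ℝ)), inferInstance, h𝒱t,
    hmem.mono fun u hu => hu.1, fun j => ⟨fun hj => ?_, fun hj => ?_⟩⟩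
  · exact tendsto_nhdsWithin_iff.2 ⟨hcoord j, hj⟩
  · refine tendsto_nhdsWithin_iff.2 ⟨hcoord j, ?_⟩
    filter_upwards [hmem, Ultrafilter.eventually_not.2 hj] with u hu hju
    exact lt_of_le_of_ne (not_lt.1 hju) (hu.2 j)

/-- Let `L` be a function of `t` whose increments are controlled by those of a monotone function
`Φ` of the coordinates, with increments under small moves determined by order relations. If `L`
agrees almost everywhere with a continuous function, then on the support the error takes only
countably many values. -/
theorem countable_image_sub_support {PT : Measure (Fin q → ℝ)}
    (hH : ∀ j c, PT {t | t j = c} = 0) {L p : (Fin q → ℝ) → ℝ} {Φ : ℝ → ℝ} (hΦ : Monotone Φ)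
    (hL : ∀ s t, |L s - L t| ≤ ∑ j, |Φ (s j) - Φ (t j)|)
    (hloc : ∀ (J : Finset (Fin q)) (s t u : Fin q → ℝ), (∀ j ∈ J, s j = t j) →
      (∀ j ∈ J, ∀ k ∉ J, ∀ y ∈ Set.uIoc (t j) (u j), (y ≤ s k ↔ y ≤ t k)) →
      L (J.piecewise u s) - L s = L (J.piecewise u t) - L t)
    (hp : Continuous p) (hae : ∀ᵐ t ∂PT, L t = p t) :
    ((fun t => L t - p t) '' PT.support).Countable := by
  classical
  have hex := fun t : PT.support => exists_filter_of_mem_support hH hae t.2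
  choose σ 𝒱 hne h𝒱 hA hσ using hex
  let D : Set ℝ := {x | ¬ ContinuousAt Φ x}
  have hD : D.Countable := hΦ.countable_not_continuousAt
  have : Countable D := hD.to_subtype
  -- The code records the coordinates lying at jumps of `Φ`, the sides of approach, and the order of
  -- the coordinates. It has countably many values and will determine the error.
  let code : PT.support → (Fin q → Option D) × (Fin q → Prop) × (Fin q → Fin q → Prop) := fun t =>
    (fun j => if h : t.1 j ∈ D then some ⟨t.1 j, h⟩ else none, σ t, fun j k => t.1 j < t.1 k)
  let J : PT.support → Finset (Fin q) := fun t => Finset.univ.filter fun j => t.1 j ∈ D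
  have hJ : ∀ t j, j ∈ J t ↔ t.1 j ∈ D := fun t j => by simp [J]
  -- Moving the coordinates outside `J t` costs nothing in the limit, since `Φ` is continuous there.
  -- The error is thus produced by the jump coordinates alone.
  have hlim : ∀ t : PT.support,
      Tendsto (fun u => L ((J t).piecewise u t.1) - L t.1) (𝒱 t) (𝓝 (p t.1 - L t.1)) := by
    intro t
    have h1 : Tendsto L (𝒱 t) (𝓝 (p t.1)) :=
      ((hp.tendsto t.1).mono_left (h𝒱 t)).congr' ((hA t).mono fun u hu => hu.symm)
    have h2 : Tendsto (fun u => L ((J t).piecewise u t.1) - L u) (𝒱 t) (𝓝 0) := by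
      refine squeeze_zero_norm (fun u => (Real.norm_eq_abs _).trans_le (hL _ _)) ?_
      rw [← Finset.sum_const_zero (s := (Finset.univ : Finset (Fin q)))]
      refine tendsto_finsetSum _ fun j _ => ?_
      by_cases hj : j ∈ J t
      · simp [hj]
      · have hc : ContinuousAt Φ (t.1 j) := by
          by_contra hc
          exact hj ((hJ t j).2 hc)
        have h3 : Tendsto (fun u : Fin q → ℝ => Φ (u j)) (𝒱 t) (𝓝 (Φ (t.1 j))) :=
          hc.tendsto.comp (((continuous_apply j).tendsto t.1).mono_left (h𝒱 t))
        have h4 := (tendsto_const_nhds (x := Φ (t.1 j))).sub h3 |>.abs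
        simpa [hj] using h4
    have h3 := (h2.add h1).sub_const (L t.1)
    simpa using h3
  have hcode : ∀ s t : PT.support, code s = code t → L s.1 - p s.1 = L t.1 - p t.1 := by
    intro s t hst
    simp only [code, Prod.mk.injEq] at hst
    obtain ⟨hc, hσst, hord⟩ := hst
    have hDst : ∀ j, (s.1 j ∈ D ↔ t.1 j ∈ D) ∧ (t.1 j ∈ D → s.1 j = t.1 j) := by
      intro j
      have h1 := congrFun hc j
      by_cases hs : s.1 j ∈ D <;> by_cases ht : t.1 j ∈ D <;> simp [hs, ht] at h1 ⊢
      exact h1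
    have hJst : J s = J t := by
      ext j
      rw [hJ, hJ, (hDst j).1]
    have hev : ∀ᶠ u in 𝒱 s, L ((J t).piecewise u s.1) - L s.1 =
        L ((J t).piecewise u t.1) - L t.1 := by
      -- A jump coordinate and a continuity coordinate are distinct, so a small move of the former
      -- does not cross the latter; the order is the same for `s` and `t`.
      have h1 : ∀ j k, ∀ᶠ u in 𝒱 s, j ∈ J t → k ∉ J t →
          ∀ y ∈ Set.uIoc (t.1 j) (u j), (y ≤ s.1 k ↔ y ≤ t.1 k) := by
        intro j k
        by_cases hj : j ∈ J t
        swap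
        · exact Eventually.of_forall fun u h => absurd h hj
        by_cases hk : k ∈ J t
        · exact Eventually.of_forall fun u _ h => absurd hk h
        have hsj := (hDst j).2 ((hJ t j).1 hj)
        have hlt : s.1 j < s.1 k ↔ t.1 j < t.1 k := by
          simpa using congrFun (congrFun hord j) k
        have hcoord : Tendsto (fun u : Fin q → ℝ => u j) (𝒱 s) (𝓝 (t.1 j)) := by
          rw [← hsj]
          exact ((continuous_apply j).tendsto s.1).mono_left (h𝒱 s)
        have hne' : ∀ x : PT.support, J x = J t → x.1 k ≠ x.1 j := by
          intro x hx h
          refine hk ?_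
          rw [← hx, hJ, h, ← hJ, hx]
          exact hj
        rcases lt_or_gt_of_ne (hne' t rfl) with h | h
        · have h' : s.1 k < t.1 j := by
            rw [← hsj]
            exact lt_of_le_of_ne (not_lt.1 fun h'' => absurd (hlt.1 h'') (not_lt.2 h.le))
              (hne' s hJst)
          filter_upwards [hcoord.eventually_const_lt h, hcoord.eventually_const_lt h']
            with u h1 h2 _ _ y hy
          have h3 : min (t.1 j) (u j) < y := hy.1
          exact iff_of_false (not_le.2 (lt_trans (lt_min h' h2) h3))
            (not_le.2 (lt_trans (lt_min h h1) h3))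
        · have h' : t.1 j < s.1 k := by
            rw [← hsj]
            exact hlt.2 h
          filter_upwards [hcoord.eventually_lt_const h, hcoord.eventually_lt_const h']
            with u h1 h2 _ _ y hy
          have h3 : y ≤ max (t.1 j) (u j) := hy.2
          exact iff_of_true (h3.trans (max_le h'.le h2.le)) (h3.trans (max_le h.le h1.le))
      filter_upwards [eventually_all.2 fun j => eventually_all.2 (h1 j)] with u hu
      exact hloc _ _ _ _ (fun j hj => (hDst j).2 ((hJ t j).1 hj))
        fun j hj k hk => hu j k hj hk
    have hls : Tendsto (fun u => L ((J t).piecewise u t.1) - L t.1) (𝒱 s) (𝓝 (p s.1 - L s.1)) := by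
      have := hlim s
      rw [hJst] at this
      exact this.congr' hev
    have hne_s := hne s
    have hne_t := hne t
    have hd1 := (hls.comp (tendsto_fst (g := 𝒱 t))).sub ((hlim t).comp (tendsto_snd (f := 𝒱 s)))
    -- Both filters approach each jump coordinate from the same side, so `Φ` has the same one-sided
    -- limit along them.
    have hd2 : Tendsto (fun x : (Fin q → ℝ) × (Fin q → ℝ) =>
        L ((J t).piecewise x.1 t.1) - L ((J t).piecewise x.2 t.1)) (𝒱 s ×ˢ 𝒱 t) (𝓝 0) := by
      refine squeeze_zero_norm (fun x => (Real.norm_eq_abs _).trans_le (hL _ _)) ?_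
      rw [← Finset.sum_const_zero (s := (Finset.univ : Finset (Fin q)))]
      refine tendsto_finsetSum _ fun j _ => ?_
      by_cases hj : j ∈ J t
      swap
      · simp [hj]
      have hsj := (hDst j).2 ((hJ t j).1 hj)
      have hside : ∃ ℓ, Tendsto (fun u : Fin q → ℝ => Φ (u j)) (𝒱 s) (𝓝 ℓ) ∧
          Tendsto (fun u : Fin q → ℝ => Φ (u j)) (𝒱 t) (𝓝 ℓ) := by
        by_cases h : σ t j
        · refine ⟨_, (hΦ.tendsto_nhdsGT (t.1 j)).comp ?_,
            (hΦ.tendsto_nhdsGT (t.1 j)).comp ((hσ t j).1 h)⟩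
          rw [← hsj]
          exact (hσ s j).1 (by rwa [hσst])
        · refine ⟨_, (hΦ.tendsto_nhdsLT (t.1 j)).comp ?_,
            (hΦ.tendsto_nhdsLT (t.1 j)).comp ((hσ t j).2 h)⟩
          rw [← hsj]
          exact (hσ s j).2 (by rwa [hσst])
      obtain ⟨ℓ, h1, h2⟩ := hside
      have h3 := ((h1.comp (tendsto_fst (g := 𝒱 t))).sub
        (h2.comp (tendsto_snd (f := 𝒱 s)))).abs
      simpa [hj, Function.comp_def] using h3
    have huniq := tendsto_nhds_unique hd1 (hd2.congr fun x => by simp)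
    linarith
  have hcount : (Set.range fun t : PT.support => L t.1 - p t.1).Countable := by
    have h1 : ∀ t, ∃ s, code s = code t := fun t => ⟨t, rfl⟩
    have hinj : Function.Injective fun x : Set.range fun t : PT.support => L t.1 - p t.1 =>
        code x.2.choose := by
      intro x y hxy
      have := hcode _ _ hxy
      have hx := x.2.choose_spec
      have hy := y.2.choose_spec
      simp only at hx hy
      exact Subtype.ext (by rw [← hx, ← hy, this])
    exact Set.countable_coe_iff.1 hinj.countable
  rw [Set.image_eq_range]
  exact hcount

/-! ### Monotonicity from countably many increments -/

/-- If `Φ` is monotone, `F` is continuous and monotone, and the increments of `Φ - F` from `a` take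
only countably many values on `[a, b]`, then `Φ` grows at least as much as `F`. -/
theorem sub_le_sub_of_countable {Φ F : ℝ → ℝ} (hΦ : Monotone Φ) (hF : Continuous F)
    {C : Set ℝ} (hC : C.Countable) {a b : ℝ} (hab : a ≤ b)
    (h : ∀ x ∈ Set.Ioc a b, (Φ x - Φ a) - (F x - F a) ∈ C) : F b - F a ≤ Φ b - Φ a := by
  by_contra hlt
  push Not at hlt
  set g : ℝ → ℝ := fun x => (Φ x - Φ a) - (F x - F a) with hg
  have hgb : g b < 0 := by simp only [hg]; linarith
  obtain ⟨v, hvC, hv1, hv2⟩ := (hC.dense_compl ℝ).exists_between hgb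
  -- `g` decreases no faster than `F` increases, so it has no downward jumps and must attain `v` on
  -- its way from `g a = 0` to `g b`.
  have hgg : ∀ x y, x ≤ y → g x - (F y - F x) ≤ g y := by
    intro x y hxy
    have := hΦ hxy
    simp only [hg]
    linarith
  let S : Set ℝ := {x | x ∈ Set.Icc a b ∧ v ≤ g x}
  have haS : a ∈ S := ⟨⟨le_rfl, hab⟩, by simp only [hg]; linarith⟩
  have hbdd : BddAbove S := ⟨b, fun x hx => hx.1.2⟩
  set z := sSup S with hz
  have haz : a ≤ z := le_csSup hbdd haS
  have hzb : z ≤ b := csSup_le ⟨a, haS⟩ fun x hx => hx.1.2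
  have hvz : v ≤ g z := by
    by_contra hlt'
    push Not at hlt'
    have h1 : ∀ᶠ x in 𝓝 z, F z - F x < v - g z := by
      have h2 : Tendsto (fun x => F z - F x) (𝓝 z) (𝓝 (F z - F z)) :=
        tendsto_const_nhds.sub (hF.tendsto z)
      exact h2.eventually_lt_const (by linarith)
    obtain ⟨ε, hε, hball⟩ := Metric.eventually_nhds_iff.1 h1
    obtain ⟨x, hxS, hx⟩ := exists_lt_of_lt_csSup ⟨a, haS⟩ (sub_lt_self z hε)
    have hxz : x ≤ z := le_csSup hbdd hxS
    have h3 := hball (y := x) (by rw [Real.dist_eq, abs_lt]; constructor <;> linarith)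
    have h4 := hgg x z hxz
    have h5 := hxS.2
    linarith
  have hzb' : z < b := lt_of_le_of_ne hzb fun h' => by rw [h'] at hvz; linarith
  have hgz : g z ≤ v := by
    by_contra hlt'
    push Not at hlt'
    have h1 : ∀ᶠ x in 𝓝 z, F x - F z < g z - v := by
      have h2 : Tendsto (fun x => F x - F z) (𝓝 z) (𝓝 (F z - F z)) :=
        (hF.tendsto z).sub tendsto_const_nhds
      exact h2.eventually_lt_const (by linarith)
    have h2 : ∀ᶠ x in 𝓝[>] z, x ∈ Set.Ioo z b := Ioo_mem_nhdsGT hzb'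
    obtain ⟨x, hx1, hx2⟩ := ((h1.filter_mono nhdsWithin_le_nhds).and h2).exists
    have h3 := hgg z x hx2.1.le
    have hxS : x ∈ S := ⟨⟨haz.trans hx2.1.le, hx2.2.le⟩, by linarith⟩
    exact absurd (le_csSup hbdd hxS) (not_le.2 hx2.1)
  have hgz' : g z = v := le_antisymm hgz hvz
  -- The hypothesis excludes `x = a`, but `g a = 0` is not the negative value `v`.
  rcases haz.eq_or_lt with h' | h'
  · rw [← h'] at hgz'
    simp only [hg] at hgz'
    linarith
  · exact hvC (hgz' ▸ h z ⟨h', hzb⟩)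

/-- A locally monotone function on the line is monotone. -/
theorem monotone_of_locally_monotone {g : ℝ → ℝ}
    (h : ∀ x, ∃ U, IsOpen U ∧ x ∈ U ∧ MonotoneOn g U) : Monotone g := by
  intro a b hab
  choose U hU hxU hmono using h
  obtain ⟨t, ht0, htm, ⟨n, hn⟩, hsub⟩ := exists_monotone_Icc_subset_open_cover_Icc hab
    (c := fun x : ℝ => ((↑) : Set.Icc a b → ℝ) ⁻¹' U x)
    (fun x => (hU x).preimage continuous_subtype_val)
    (fun x _ => Set.mem_iUnion.2 ⟨x.1, hxU x.1⟩)
  have hstep : ∀ k, g a ≤ g (t k) := by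
    intro k
    induction k with
    | zero => rw [ht0]
    | succ k ih =>
      obtain ⟨x, hx⟩ := hsub k
      have hle := htm (Nat.le_succ k)
      exact ih.trans (hmono x (hx ⟨le_rfl, hle⟩) (hx ⟨hle, le_rfl⟩) hle)
  have := hstep n
  rwa [hn n le_rfl] at this

/-! ### Setwise limits along a filter -/

/-- `M` is the setwise limit of the probability measures `F n` along the filter `𝒰`. -/
def IsLimitContent (𝒰 : Filter ℕ) (F : ℕ → ProbabilityMeasure ℝ) (M : Set ℝ → ℝ) : Prop :=
  ∀ A, Tendsto (fun n => (F n : Measure ℝ).real A) 𝒰 (𝓝 (M A))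

/-- Compactness of `[0, 1]` gives a limit on every set along one ultrafilter, at the price of
countable additivity. -/
theorem exists_isLimitContent (𝒰 : Ultrafilter ℕ) (F : ℕ → ProbabilityMeasure ℝ) :
    ∃ M, IsLimitContent 𝒰 F M := by
  have : ∀ A, ∃ x, Tendsto (fun n => (F n : Measure ℝ).real A) 𝒰 (𝓝 x) := by
    intro A
    have h := (isCompact_Icc (a := (0 : ℝ)) (b := 1)).ultrafilter_le_nhds
      (𝒰.map fun n => (F n : Measure ℝ).real A) ?_
    · obtain ⟨x, -, hx⟩ := h
      exact ⟨x, hx⟩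
    · rw [le_principal_iff]
      exact Ultrafilter.mem_map.2
        (Eventually.of_forall fun n => ⟨measureReal_nonneg, measureReal_le_one⟩)
  choose M hM using this
  exact ⟨M, hM⟩

namespace IsLimitContent

variable {𝒰 : Filter ℕ} [𝒰.NeBot] {F : ℕ → ProbabilityMeasure ℝ} {M : Set ℝ → ℝ}

theorem nonneg (hM : IsLimitContent 𝒰 F M) (A : Set ℝ) : 0 ≤ M A :=
  ge_of_tendsto' (hM A) fun _ => measureReal_nonneg

theorem le_one (hM : IsLimitContent 𝒰 F M) (A : Set ℝ) : M A ≤ 1 :=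
  le_of_tendsto' (hM A) fun _ => measureReal_le_one

theorem mono (hM : IsLimitContent 𝒰 F M) {A B : Set ℝ} (h : A ⊆ B) : M A ≤ M B :=
  le_of_tendsto_of_tendsto' (hM A) (hM B) fun _ => measureReal_mono h

theorem monotone_Iic (hM : IsLimitContent 𝒰 F M) : Monotone fun x => M (Set.Iic x) :=
  fun _ _ h => hM.mono (Set.Iic_subset_Iic.2 h)

theorem union (hM : IsLimitContent 𝒰 F M) {A B : Set ℝ} (h : Disjoint A B)
    (hB : MeasurableSet B) : M (A ∪ B) = M A + M B :=
  tendsto_nhds_unique (hM _) (((hM A).add (hM B)).congr fun _ => (measureReal_union h hB).symm)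

theorem sum_eq_one (hM : IsLimitContent 𝒰 F M) {ι : Type*} [Fintype ι] (A : ι → Set ℝ)
    (h : ∀ n, ∑ i, (F n : Measure ℝ).real (A i) = 1) : ∑ i, M (A i) = 1 :=
  tendsto_nhds_unique (tendsto_finsetSum _ fun i _ => hM (A i))
    (tendsto_const_nhds.congr fun n => (h n).symm)

theorem sub_Iic (hM : IsLimitContent 𝒰 F M) {a b : ℝ} (h : a ≤ b) :
    M (Set.Iic b) - M (Set.Iic a) = M (Set.Ioc a b) := by
  rw [← Set.Iic_union_Ioc_eq_Iic h, hM.union (Set.Iic_disjoint_Ioc le_rfl) measurableSet_Ioc]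
  ring

theorem abs_sub_le (hM : IsLimitContent 𝒰 F M) {R : RangeMap q m} (hR : Monotonicity R)
    (s t : Fin q → ℝ) (i : Fin m) :
    |M (R.range s i) - M (R.range t i)| ≤ ∑ j, M (Set.uIoc (s j) (t j)) :=
  le_of_tendsto_of_tendsto' ((hM _).sub (hM _)).abs (tendsto_finsetSum _ fun _ _ => hM _)
    fun n => hR.abs_real_sub_le (F n : Measure ℝ) s t i

theorem abs_sub_le_Iic (hM : IsLimitContent 𝒰 F M) {R : RangeMap q m} (hR : Monotonicity R)
    (s t : Fin q → ℝ) (i : Fin m) :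
    |M (R.range s i) - M (R.range t i)| ≤ ∑ j, |M (Set.Iic (s j)) - M (Set.Iic (t j))| := by
  refine le_of_tendsto_of_tendsto' ((hM _).sub (hM _)).abs
    (tendsto_finsetSum _ fun j _ => ((hM _).sub (hM _)).abs) fun n => ?_
  simp only [← cdf_eq_real]
  exact hR.abs_real_sub_le_cdf (F n : Measure ℝ) s t i

theorem piecewise_sub_eq (hM : IsLimitContent 𝒰 F M) {R : RangeMap q m} (hR : Monotonicity R)
    (i : Fin m) (J : Finset (Fin q)) (s t u : Fin q → ℝ) (hst : ∀ j ∈ J, s j = t j)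
    (ht : ∀ j ∈ J, ∀ k ∉ J, ∀ y ∈ Set.uIoc (t j) (u j), (y ≤ s k ↔ y ≤ t k)) :
    M (R.range (J.piecewise u s) i) - M (R.range s i) =
      M (R.range (J.piecewise u t) i) - M (R.range t i) :=
  tendsto_nhds_unique ((hM _).sub (hM _)) (((hM _).sub (hM _)).congr fun n =>
    (hR.real_piecewise_sub_eq (F n : Measure ℝ) J s t u hst ht i).symm)

end IsLimitContent

/-! ### Identification of the limiting distribution function -/

theorem real_Ioc (F : Measure ℝ) [IsProbabilityMeasure F] {a b : ℝ} (h : a ≤ b) :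
    F.real (Set.Ioc a b) = cdf F b - cdf F a := by
  rw [← Set.uIoc_of_le h, real_uIoc, abs_of_nonneg (sub_nonneg.2 (monotone_cdf F h))]

/-- If the limiting range probabilities agree almost everywhere with the true ones, then the
limiting distribution function is the true one. -/
theorem limit_Iic_eq_cdf {𝒴 : Set ℝ} {R : RangeMap q m} {PT : Measure (Fin q → ℝ)}
    {PY : Measure ℝ} [IsProbabilityMeasure PY] (hH : ∀ j c, PT {t | t j = c} = 0)
    (hres : Resolvability 𝒴 R PT) (hR : Monotonicity R) (hcont : Continuous (cdf PY))
    (h𝒴 : ∀ᵐ y ∂PY, y ∈ 𝒴) {𝒰 : Filter ℕ} [𝒰.NeBot] {F : ℕ → ProbabilityMeasure ℝ}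
    {M : Set ℝ → ℝ} (hM : IsLimitContent 𝒰 F M)
    (hae : ∀ i, ∀ᵐ t ∂PT, M (R.range t i) = PY.real (R.range t i)) (x : ℝ) :
    M (Set.Iic x) = cdf PY x := by
  let e : Fin m → (Fin q → ℝ) → ℝ := fun i t => M (R.range t i) - PY.real (R.range t i)
  have he : ∀ i, (e i '' PT.support).Countable := fun i =>
    countable_image_sub_support hH hM.monotone_Iic (fun s t => hM.abs_sub_le_Iic hR s t i)
      (hM.piecewise_sub_eq hR i) (hR.continuous_real_range PY hcont i) (hae i)
  let E : Set ℝ := ⋃ i, e i '' PT.support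
  have hE : E.Countable := Set.countable_iUnion he
  let C : Set ℝ := (fun x : ℝ × ℝ => x.1 - x.2) '' (E ×ˢ E)
  have hC : C.Countable := (hE.prod hE).image _
  have hmono : Monotone fun x => M (Set.Iic x) - cdf PY x := by
    refine monotone_of_locally_monotone fun y => ?_
    by_cases hy : y ∈ closure 𝒴
    · obtain ⟨N, hN, hyN, hNres⟩ := hres.2 y hy
      obtain ⟨ε, hε, hball⟩ := Metric.isOpen_iff.1 hN y hyN
      refine ⟨Metric.ball y ε, Metric.isOpen_ball, Metric.mem_ball_self hε, fun a ha b hb hab => ?_⟩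
      have hincr : ∀ x ∈ Set.Ioc a b,
          (M (Set.Iic x) - M (Set.Iic a)) - (cdf PY x - cdf PY a) ∈ C := by
        intro x hx
        have hxN : x ∈ N := by
          refine hball ?_
          rw [Real.ball_eq_Ioo] at ha hb ⊢
          exact ⟨ha.1.trans hx.1, hx.2.trans_lt hb.2⟩
        obtain ⟨t, ht, t', ht', k, l, hd, hu⟩ := hNres a (hball ha) x hxN
        have hdisj : Disjoint (Set.Ioc a x) (R.range t k) := Set.disjoint_iff_inter_eq_empty.2 hd
        have h1 := hM.union hdisj (R.measurableSet_range t k)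
        have h2 := measureReal_union (μ := PY) hdisj (R.measurableSet_range t k)
        rw [hu] at h1 h2
        rw [hM.sub_Iic hx.1.le, ← real_Ioc PY hx.1.le]
        -- The interval is the difference of two ranges, so its error is the difference of their
        -- errors.
        refine ⟨(e l t', e k t), ⟨Set.mem_iUnion.2 ⟨l, t', ht', rfl⟩,
          Set.mem_iUnion.2 ⟨k, t, ht, rfl⟩⟩, ?_⟩
        simp only [e, h1, h2]
        ring
      have := sub_le_sub_of_countable hM.monotone_Iic hcont hC hab hincr
      simp only
      linarith
    · obtain ⟨ε, hε, hball⟩ := Metric.isOpen_iff.1 isClosed_closure.isOpen_compl y hy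
      refine ⟨Metric.ball y ε, Metric.isOpen_ball, Metric.mem_ball_self hε, fun a ha b hb hab => ?_⟩
      -- Away from the closure of `𝒴`, `F_Y` is flat and the monotonicity of `M` suffices.
      have h0 : cdf PY b - cdf PY a = 0 := by
        rw [← real_Ioc PY hab, measureReal_eq_zero_iff]
        refine measure_mono_null (fun x hx => ?_) h𝒴
        have hx' : x ∈ Metric.ball y ε := by
          rw [Real.ball_eq_Ioo] at ha hb ⊢
          exact ⟨ha.1.trans hx.1, hx.2.trans_lt hb.2⟩
        exact fun h => hball hx' (subset_closure h)
      have := hM.monotone_Iic hab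
      simp only at this ⊢
      linarith
  -- The bounds `0 ≤ M ≤ 1` suffice at both ends: the nondecreasing difference is at least `-F_Y(z)`
  -- as `z → -∞` and at most `1 - F_Y(z)` as `z → ∞`. No tightness of `M` is needed.
  have hlow : cdf PY x ≤ M (Set.Iic x) := by
    have h1 : ∀ᶠ z in atBot, -cdf PY z ≤ M (Set.Iic x) - cdf PY x := by
      filter_upwards [eventually_le_atBot x] with z hz
      have := hmono hz
      have := hM.nonneg (Set.Iic z)
      simp only at *
      linarith
    have h2 := le_of_tendsto (tendsto_cdf_atBot PY).neg h1
    linarith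
  have hup : M (Set.Iic x) ≤ cdf PY x := by
    have h1 : ∀ᶠ z in atTop, M (Set.Iic x) - cdf PY x ≤ 1 - cdf PY z := by
      filter_upwards [eventually_ge_atTop x] with z hz
      have := hmono hz
      have := hM.le_one (Set.Iic z)
      simp only at *
      linarith
    have h2 := ge_of_tendsto ((tendsto_cdf_atTop PY).const_sub 1) h1
    linarith
  exact le_antisymm hup hlow

/-! ### Quantile cells on the line -/

/-- A set on which the distribution function of an atomless law oscillates by at most `δ` has
probability at most `δ`. -/
theorem real_le_of_cdf_sub_le (ν : Measure ℝ) [IsProbabilityMeasure ν] [NullSingletonClass ν] {S : Set ℝ}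
    (hS : MeasurableSet S) {δ : ℝ} (hδ : 0 ≤ δ) (h : ∀ a ∈ S, ∀ b ∈ S, cdf ν b - cdf ν a ≤ δ) :
    ν.real S ≤ δ := by
  refine ENNReal.toReal_le_of_le_ofReal hδ ?_
  -- Inner regularity reduces to compact sets, which contain their infimum and supremum.
  rw [hS.measure_eq_iSup_isCompact]
  refine iSup₂_le fun K hKS => iSup_le fun hK => ?_
  rcases K.eq_empty_or_nonempty with rfl | hne
  · simp
  have h1 := hK.sInf_mem hne
  have h2 := hK.sSup_mem hne
  have hsub : K ⊆ Set.Icc (sInf K) (sSup K) := fun x hx =>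
    ⟨csInf_le hK.bddBelow hx, le_csSup hK.bddAbove hx⟩
  have hle : sInf K ≤ sSup K := (hsub h1).2
  calc ν K ≤ ν (Set.Icc (sInf K) (sSup K)) := measure_mono hsub
    _ = ν (Set.Ioc (sInf K) (sSup K)) := (measure_congr Ioc_ae_eq_Icc).symm
    _ = ENNReal.ofReal (ν.real (Set.Ioc (sInf K) (sSup K))) := (ofReal_measureReal).symm
    _ ≤ ENNReal.ofReal δ := by
      rw [real_Ioc ν hle]
      exact ENNReal.ofReal_le_ofReal (h _ (hKS h1) _ (hKS h2))

/-- The index of the cell containing `x` in the division of the line at the quantiles of `ν`. -/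
noncomputable def quantileIndex (ν : Measure ℝ) (K : ℕ) (x : ℝ) : Fin (K + 1) :=
  -- The index `K` occurs where the distribution function equals 1, hence `K + 1` cells.
  ⟨⌊K * cdf ν x⌋₊, Nat.lt_succ_of_le (Nat.floor_le_of_le
    (mul_le_of_le_one_right (Nat.cast_nonneg K) (cdf_le_one ν x)))⟩

/-- The `k`-th cell in the division of the line at the quantiles of `ν`. -/
def quantileCell (ν : Measure ℝ) (K : ℕ) (k : Fin (K + 1)) : Set ℝ := {x | quantileIndex ν K x = k}

theorem monotone_quantileIndex (ν : Measure ℝ) (K : ℕ) : Monotone (quantileIndex ν K) :=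
  fun _ _ h => Fin.mk_le_mk.2 (Nat.floor_mono
    (mul_le_mul_of_nonneg_left (monotone_cdf ν h) (Nat.cast_nonneg K)))

theorem measurable_quantileIndex (ν : Measure ℝ) (K : ℕ) : Measurable (quantileIndex ν K) :=
  (monotone_quantileIndex ν K).measurable

theorem measurableSet_quantileCell (ν : Measure ℝ) (K : ℕ) (k : Fin (K + 1)) :
    MeasurableSet (quantileCell ν K k) :=
  measurable_quantileIndex ν K (measurableSet_singleton k)

theorem uIoc_subset_quantileCell {ν : Measure ℝ} {K : ℕ} {k : Fin (K + 1)} {x y : ℝ}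
    (hx : x ∈ quantileCell ν K k) (hy : y ∈ quantileCell ν K k) :
    Set.uIoc x y ⊆ quantileCell ν K k := by
  have key : ∀ x y : ℝ, x ∈ quantileCell ν K k → y ∈ quantileCell ν K k →
      Set.Ioc x y ⊆ quantileCell ν K k := fun x y hx hy z hz =>
    le_antisymm ((monotone_quantileIndex ν K hz.2).trans_eq hy)
      (hx.symm.trans_le (monotone_quantileIndex ν K hz.1.le))
  rw [Set.uIoc_eq_union]
  exact Set.union_subset (key x y hx hy) (key y x hy hx)

theorem cdf_sub_le_of_mem_quantileCell {ν : Measure ℝ} {K : ℕ} (hK : 0 < K) {k : Fin (K + 1)}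
    {x y : ℝ} (hx : x ∈ quantileCell ν K k) (hy : y ∈ quantileCell ν K k) :
    cdf ν y - cdf ν x ≤ 1 / K := by
  have h1 : ⌊K * cdf ν x⌋₊ = ⌊K * cdf ν y⌋₊ := congrArg Fin.val (hx.trans hy.symm)
  have h2 : (⌊K * cdf ν x⌋₊ : ℝ) ≤ K * cdf ν x :=
    Nat.floor_le (mul_nonneg (Nat.cast_nonneg K) (cdf_nonneg ν x))
  have h3 : K * cdf ν y < ⌊K * cdf ν y⌋₊ + 1 := Nat.lt_floor_add_one _
  rw [← h1] at h3
  have hK' : (0 : ℝ) < K := Nat.cast_pos.2 hK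
  rw [le_div_iff₀ hK']
  linarith

theorem real_quantileCell_le (ν : Measure ℝ) [IsProbabilityMeasure ν] [NullSingletonClass ν] {K : ℕ}
    (hK : 0 < K) (k : Fin (K + 1)) : ν.real (quantileCell ν K k) ≤ 1 / K :=
  real_le_of_cdf_sub_le ν (measurableSet_quantileCell ν K k) (by positivity)
    fun _ ha _ hb => cdf_sub_le_of_mem_quantileCell hK ha hb

theorem sum_real_quantileCell (ν F : Measure ℝ) [IsProbabilityMeasure F] (K : ℕ) :
    ∑ k, F.real (quantileCell ν K k) = 1 := by
  have hdisj : Set.PairwiseDisjoint (Finset.univ : Finset (Fin (K + 1)))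
      (quantileCell ν K) := fun k _ l _ hkl =>
    Set.disjoint_left.2 fun x hx hx' => hkl (hx.symm.trans hx')
  rw [← measureReal_biUnion_finset hdisj fun k _ => measurableSet_quantileCell ν K k]
  have : (⋃ k ∈ (Finset.univ : Finset (Fin (K + 1))), quantileCell ν K k) = Set.univ := by
    ext x
    simp [quantileCell]
  rw [this]
  simp

/-! ### Uniform convergence -/

/-- Pointwise convergence of distribution functions to a continuous distribution function is
uniform. -/
theorem tendsto_iSup_abs_cdf_sub {PY : Measure ℝ} [IsProbabilityMeasure PY]
    (hcont : Continuous (cdf PY)) {F : ℕ → ProbabilityMeasure ℝ}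
    (h : ∀ x, Tendsto (fun n => cdf (F n : Measure ℝ) x) atTop (𝓝 (cdf PY x))) (𝒴 : Set ℝ) :
    Tendsto (fun n => ⨆ y : 𝒴, |cdf (F n : Measure ℝ) (y : ℝ) - cdf PY (y : ℝ)|) atTop (𝓝 0) := by
  have hgrid : ∀ v ∈ Set.Ioo (0 : ℝ) 1, ∃ x, cdf PY x = v := fun v hv =>
    mem_range_of_exists_le_of_exists_ge hcont
      (((tendsto_cdf_atBot PY).eventually_le_const hv.1).exists)
      (((tendsto_cdf_atTop PY).eventually_const_le hv.2).exists)
  have hkey : ∀ K : ℕ, 0 < K → ∀ᶠ n in atTop, ∀ x : ℝ,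
      |cdf (F n : Measure ℝ) x - cdf PY x| ≤ 3 / K := by
    intro K hK
    have hK' : (0 : ℝ) < K := Nat.cast_pos.2 hK
    have h1 : ∀ k : Fin K, ∀ᶠ n in atTop, ∀ v : ℝ, v = (k : ℕ) / K → 0 < v →
        ∃ x, cdf PY x = v ∧ |cdf (F n : Measure ℝ) x - v| < 1 / K := by
      intro k
      by_cases hv : (0 : ℝ) < (k : ℕ) / K
      · have hv1 : ((k : ℕ) : ℝ) / K < 1 := by
          rw [div_lt_one hK']
          exact_mod_cast k.2
        obtain ⟨x, hx⟩ := hgrid _ ⟨hv, hv1⟩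
        have h2 := ((h x).sub_const (cdf PY x)).abs
        rw [sub_self, abs_zero] at h2
        filter_upwards [h2.eventually_lt_const (one_div_pos.2 hK')] with n hn v hv' _
        exact ⟨x, hx.trans hv'.symm, by rwa [hv', ← hx]⟩
      · exact Eventually.of_forall fun n v hv' h0 => absurd (hv' ▸ h0) hv
    filter_upwards [eventually_all.2 h1] with n hn x
    have hstep : ∀ k : ℕ, 0 < k → k < K → ∃ z, cdf PY z = (k : ℝ) / K ∧
        |cdf (F n : Measure ℝ) z - k / K| < 1 / K := fun k hk hkK =>
      hn ⟨k, hkK⟩ _ rfl (div_pos (Nat.cast_pos.2 hk) hK')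
    set k := ⌊K * cdf PY x⌋₊ with hk
    have h2 : (k : ℝ) / K ≤ cdf PY x := by
      rw [div_le_iff₀' hK']
      exact Nat.floor_le (mul_nonneg hK'.le (cdf_nonneg PY x))
    have h3 : cdf PY x < (k + 1) / K := by
      rw [lt_div_iff₀' hK']
      exact Nat.lt_floor_add_one _
    have h30 : (3 : ℝ) / K = 1 / K + 1 / K + 1 / K := by ring
    have h31 : (k + 1 : ℝ) / K = k / K + 1 / K := by ring
    have hpos : (0 : ℝ) < 1 / K := one_div_pos.2 hK'
    have hmono := monotone_cdf (F n : Measure ℝ)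
    have hmono0 := monotone_cdf PY
    rw [abs_le]
    constructor
    · rcases Nat.lt_or_ge 1 k with h4 | h4
      · have hkK : k ≤ K := by
          have h5 : (k : ℝ) / K ≤ 1 := h2.trans (cdf_le_one PY x)
          rw [div_le_one hK'] at h5
          exact_mod_cast h5
        -- Here `k = K` is possible and the level 1 need not be attained, so the level one step
        -- lower is used.
        obtain ⟨z, hz1, hz2⟩ := hstep (k - 1) (by omega) (by omega)
        rw [Nat.cast_sub h4.le, Nat.cast_one, sub_div] at hz1 hz2
        have hzx : z ≤ x := by
          by_contra h5
          have := hmono0 (not_le.1 h5).le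
          linarith
        have := hmono hzx
        have := (abs_lt.1 hz2).1
        linarith
      · have h5 : (k : ℝ) / K ≤ 1 / K := by
          gcongr
          exact_mod_cast h4
        have := cdf_nonneg (F n : Measure ℝ) x
        linarith
    · rcases Nat.lt_or_ge (k + 1) K with h4 | h4
      · obtain ⟨z, hz1, hz2⟩ := hstep (k + 1) (by omega) h4
        push_cast at hz1 hz2
        have hxz : x ≤ z := by
          by_contra h5
          have := hmono0 (not_le.1 h5).le
          linarith
        have := hmono hxz
        have := (abs_lt.1 hz2).2
        linarith
      · have h5 : (1 : ℝ) ≤ (k + 1) / K := by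
          rw [one_le_div hK']
          exact_mod_cast h4
        have := cdf_le_one (F n : Measure ℝ) x
        linarith
  rw [Metric.tendsto_atTop]
  intro ε hε
  obtain ⟨K, hK⟩ := exists_nat_gt (3 / ε)
  have hK0 : (0 : ℝ) < K := (by positivity : (0 : ℝ) < 3 / ε).trans hK
  have hKε : 3 / (K : ℝ) < ε := by
    rw [div_lt_iff₀ hε] at hK
    rw [div_lt_iff₀ hK0]
    linarith
  obtain ⟨n₀, hn₀⟩ := eventually_atTop.1 (hkey K (Nat.cast_pos.1 hK0))
  refine ⟨n₀, fun n hn => ?_⟩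
  rw [Real.dist_eq, sub_zero, abs_of_nonneg (Real.iSup_nonneg fun _ => abs_nonneg _)]
  exact (Real.iSup_le (fun y : 𝒴 => hn₀ n hn y.1) (by positivity)).trans_lt hKε

/-! ### Product cells and empirical scores -/

/-- The multi-index of the product cell containing `t`, for the marginal quantiles of `PT`. -/
noncomputable def cellIndex (PT : Measure (Fin q → ℝ)) (K : ℕ) (t : Fin q → ℝ) :
    Fin q → Fin (K + 1) :=
  fun j => quantileIndex (PT.map fun t => t j) K (t j)

open Classical in
/-- A representative point of the product cell of index `κ`. -/
noncomputable def cellPoint (PT : Measure (Fin q → ℝ)) (K : ℕ) (κ : Fin q → Fin (K + 1)) :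
    Fin q → ℝ :=
  fun j => if h : (quantileCell (PT.map fun t => t j) K (κ j)).Nonempty then h.choose else 0

theorem uIoc_cellPoint_subset (PT : Measure (Fin q → ℝ)) (K : ℕ) (t : Fin q → ℝ) (j : Fin q) :
    Set.uIoc (t j) (cellPoint PT K (cellIndex PT K t) j) ⊆
      quantileCell (PT.map fun t => t j) K (cellIndex PT K t j) := by
  -- The point `t j` lies in its own cell, so the default 0 of `cellPoint` is not used here.
  have h : (quantileCell (PT.map fun t => t j) K (cellIndex PT K t j)).Nonempty := ⟨t j, rfl⟩
  refine uIoc_subset_quantileCell rfl ?_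
  rw [cellPoint, dif_pos h]
  exact h.choose_spec

theorem measurable_cellIndex (PT : Measure (Fin q → ℝ)) (K : ℕ) :
    Measurable (cellIndex PT K) :=
  measurable_pi_lambda _ fun j => (measurable_quantileIndex _ K).comp (measurable_pi_apply j)

/-- The score `1{t ∈ cell κ, y ∈ R_t^(i)} F_Y(R_t^(i))` of an observation `(t, y)`. -/
noncomputable def cellScore (R : RangeMap q m) (PT : Measure (Fin q → ℝ)) (PY : Measure ℝ) (K : ℕ)
    (p : (Fin q → Fin (K + 1)) × Fin m) : (Fin q → ℝ) × ℝ → ℝ :=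
  Set.indicator {x | cellIndex PT K x.1 = p.1 ∧ x.2 ∈ R.range x.1 p.2}
    fun x => PY.real (R.range x.1 p.2)

theorem measurable_cellScore {R : RangeMap q m} (hR : Monotonicity R) (PT : Measure (Fin q → ℝ))
    (PY : Measure ℝ) [IsProbabilityMeasure PY] (K : ℕ) (p : (Fin q → Fin (K + 1)) × Fin m) :
    Measurable (cellScore R PT PY K p) := by
  refine ((hR.measurable_real_range PY p.2).comp measurable_fst).indicator ?_
  exact (((measurable_cellIndex PT K).comp measurable_fst) (measurableSet_singleton p.1)).inter
    (hR.measurableSet_mem_range p.2)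

theorem abs_cellScore_le (R : RangeMap q m) (PT : Measure (Fin q → ℝ))
    (PY : Measure ℝ) [IsProbabilityMeasure PY] (K : ℕ) (p : (Fin q → Fin (K + 1)) × Fin m)
    (x : (Fin q → ℝ) × ℝ) : |cellScore R PT PY K p x| ≤ 1 := by
  unfold cellScore
  by_cases h : x ∈ {x : (Fin q → ℝ) × ℝ | cellIndex PT K x.1 = p.1 ∧ x.2 ∈ R.range x.1 p.2}
  · rw [Set.indicator_of_mem h, abs_of_nonneg measureReal_nonneg]
    exact measureReal_le_one
  · rw [Set.indicator_of_notMem h]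
    simp

/-- Each observation meets exactly one pair of cell and range. Weights depending on `F̂_n` can thus
be pulled out of the empirical average, leaving finitely many fixed scores. -/
theorem sum_mul_cellScore (R : RangeMap q m) (PT : Measure (Fin q → ℝ)) (PY : Measure ℝ) (K : ℕ)
    (a : (Fin q → Fin (K + 1)) × Fin m → ℝ) {t : Fin q → ℝ} {y : ℝ} {i : Fin m}
    (hi : y ∈ R.range t i) :
    ∑ p, a p * cellScore R PT PY K p (t, y) =
      a (cellIndex PT K t, i) * PY.real (R.range t i) := by
  rw [Finset.sum_eq_single (cellIndex PT K t, i)]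
  · rw [cellScore, Set.indicator_of_mem]
    exact ⟨rfl, hi⟩
  · rintro ⟨κ, k⟩ - hne
    rw [cellScore, Set.indicator_of_notMem, mul_zero]
    rintro ⟨h1, h2⟩
    refine hne (Prod.ext h1.symm ?_)
    by_contra hk
    exact Set.disjoint_left.1 (R.disjoint_range t k i hk) h2 hi
  · simp

/-- Integrating out `y` contributes a second factor `F_Y(R_t^(i))`, whence the square. -/
theorem integral_sum_mul_cellScore {R : RangeMap q m} (hR : Monotonicity R)
    (PT : Measure (Fin q → ℝ)) [IsProbabilityMeasure PT] (PY : Measure ℝ) [IsProbabilityMeasure PY]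
    (K : ℕ) (a : (Fin q → Fin (K + 1)) × Fin m → ℝ) :
    ∑ p, a p * ∫ x, cellScore R PT PY K p x ∂(PT.prod PY) =
      ∫ t, ∑ i, a (cellIndex PT K t, i) * PY.real (R.range t i) ^ 2 ∂PT := by
  have hint : ∀ p, Integrable (cellScore R PT PY K p) (PT.prod PY) := fun p =>
    Integrable.of_bound (measurable_cellScore hR PT PY K p).aestronglyMeasurable 1
      (Eventually.of_forall fun x => abs_cellScore_le R PT PY K p x)
  simp_rw [← integral_const_mul]
  rw [← integral_finsetSum _ fun p _ => (hint p).const_mul _,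
    integral_prod _ (integrable_finsetSum _ fun p _ => (hint p).const_mul _)]
  congr 1
  ext t
  have h1 : ∀ y, ∑ p, a p * cellScore R PT PY K p (t, y) =
      ∑ i, (R.range t i).indicator
        (fun _ => a (cellIndex PT K t, i) * PY.real (R.range t i)) y := by
    intro y
    obtain ⟨i, hi, -⟩ := R.existsUnique_mem_range t y
    rw [sum_mul_cellScore R PT PY K a hi, R.sum_indicator_range t hi
      fun i => a (cellIndex PT K t, i) * PY.real (R.range t i)]
  simp_rw [h1]
  rw [integral_finsetSum _ fun i _ => (integrable_const _).indicator (R.measurableSet_range t i)]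
  refine Finset.sum_congr rfl fun i _ => ?_
  rw [integral_indicator_const _ (R.measurableSet_range t i), smul_eq_mul]
  ring

theorem sum_mul_indicator_quantileCell (ν : Measure ℝ) (K : ℕ) (f : Fin (K + 1) → ℝ) (x : ℝ) :
    ∑ k, f k * (quantileCell ν K k).indicator 1 x = f (quantileIndex ν K x) := by
  rw [Finset.sum_eq_single (quantileIndex ν K x)]
  · rw [Set.indicator_of_mem (show x ∈ quantileCell ν K (quantileIndex ν K x) from rfl)]
    simp
  · intro k _ hk
    have hx : x ∉ quantileCell ν K k := fun h => hk (Eq.symm h)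
    rw [Set.indicator_of_notMem hx, mul_zero]
  · simp

theorem sum_prod_mul_indicator_quantileCell (PT : Measure (Fin q → ℝ)) (K : ℕ)
    (f : Fin q → Fin (K + 1) → ℝ) (t : Fin q → ℝ) :
    ∑ p : Fin q × Fin (K + 1),
      f p.1 p.2 * (quantileCell (PT.map fun t => t p.1) K p.2).indicator 1 (t p.1) =
        ∑ j, f j (cellIndex PT K t j) := by
  rw [Fintype.sum_prod_type]
  refine Finset.sum_congr rfl fun j _ => ?_
  have h := sum_mul_indicator_quantileCell (PT.map fun t : Fin q → ℝ => t j) K (f j) (t j)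
  rw [cellIndex, ← h]

theorem sum_mul_average {ι : Type*} [Fintype ι] (a : ι → ℝ) (s : ι → ℕ → ℝ) (n : ℕ) :
    ∑ p, a p * ((∑ j ∈ Finset.range n, s p j) / n) =
      (∑ j ∈ Finset.range n, ∑ p, a p * s p j) / n := by
  simp_rw [← mul_div_assoc, Finset.mul_sum]
  rw [← Finset.sum_div, Finset.sum_comm]

/-- On the nonnegative axis `x ↦ (x + δ)⁻¹` is Lipschitz with constant `δ⁻²`. -/
theorem inv_add_sub_le {a b δ : ℝ} (ha : 0 ≤ a) (hb : 0 ≤ b) (hδ : 0 < δ) :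
    (b + δ)⁻¹ - (δ ^ 2)⁻¹ * |a - b| ≤ (a + δ)⁻¹ := by
  have h1 : 0 < a + δ := by linarith
  have h2 : 0 < b + δ := by linarith
  have h3 : (b + δ)⁻¹ - (a + δ)⁻¹ = (a - b) * ((a + δ) * (b + δ))⁻¹ := by
    field_simp
    ring
  have h4 : (a - b) * ((a + δ) * (b + δ))⁻¹ ≤ |a - b| * (δ ^ 2)⁻¹ := by
    refine mul_le_mul (le_abs_self _) ?_ (by positivity) (abs_nonneg _)
    refine inv_anti₀ (by positivity) ?_
    nlinarith [mul_nonneg ha hb, mul_nonneg ha hδ.le, mul_nonneg hb hδ.le]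
  rw [mul_comm] at h4
  linarith [mul_comm (δ ^ 2)⁻¹ |a - b|]

/-- Adding `δ` lowers the ratio and makes it Lipschitz in the denominator; passing to the cell point
then costs at most `δ⁻²` times the `F`-mass of the coordinate cells. -/
theorem cellPoint_score_le {R : RangeMap q m} (hR : Monotonicity R) (PT : Measure (Fin q → ℝ))
    (PY F : Measure ℝ) [IsProbabilityMeasure PY] [IsProbabilityMeasure F] (K : ℕ) {δ : ℝ}
    (hδ : 0 < δ) (t : Fin q → ℝ) (i : Fin m) (hpos : 0 < F.real (R.range t i)) :
    (F.real (R.range (cellPoint PT K (cellIndex PT K t)) i) + δ)⁻¹ * PY.real (R.range t i) -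
        (δ ^ 2)⁻¹ * ∑ j, F.real (quantileCell (PT.map fun t => t j) K (cellIndex PT K t j)) ≤
      PY.real (R.range t i) / F.real (R.range t i) := by
  set t' := cellPoint PT K (cellIndex PT K t) with ht'
  set W := ∑ j, F.real (quantileCell (PT.map fun t => t j) K (cellIndex PT K t j)) with hW
  have hW0 : 0 ≤ W := Finset.sum_nonneg fun _ _ => measureReal_nonneg
  have h1 : |F.real (R.range t i) - F.real (R.range t' i)| ≤ W :=
    (hR.abs_real_sub_le F t t' i).trans
      (Finset.sum_le_sum fun j _ => measureReal_mono (uIoc_cellPoint_subset PT K t j))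
  have h2 := inv_add_sub_le hpos.le (measureReal_nonneg (μ := F) (s := R.range t' i)) hδ
  have h3 : (F.real (R.range t i) + δ)⁻¹ ≤ (F.real (R.range t i))⁻¹ :=
    inv_anti₀ hpos (by linarith)
  have hp0 : 0 ≤ PY.real (R.range t i) := measureReal_nonneg
  have hp1 : PY.real (R.range t i) ≤ 1 := measureReal_le_one
  have hδ2 : 0 < (δ ^ 2)⁻¹ := by positivity
  have h4 : (F.real (R.range t' i) + δ)⁻¹ - (δ ^ 2)⁻¹ * W ≤ (F.real (R.range t i))⁻¹ := by
    have := mul_le_mul_of_nonneg_left h1 hδ2.le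
    linarith
  have h5 := mul_le_mul_of_nonneg_right h4 hp0
  rw [div_eq_inv_mul]
  have h6 : (δ ^ 2)⁻¹ * W * PY.real (R.range t i) ≤ (δ ^ 2)⁻¹ * W :=
    mul_le_of_le_one_right (by positivity) hp1
  nlinarith

/-! ### The optimality condition in the limit -/

section Limit

variable {R : RangeMap q m} {PT : Measure (Fin q → ℝ)} [IsProbabilityMeasure PT]
  {PY : Measure ℝ} [IsProbabilityMeasure PY] {𝒰 : Filter ℕ} [𝒰.NeBot]
  {F : ℕ → ProbabilityMeasure ℝ} {M : Set ℝ → ℝ}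

/-- `M` may concentrate on a single cell, but every cell has mass at most `1 / K` under the atomless
marginal of `PT`, and the `M`-masses sum to 1. -/
theorem sum_mul_real_quantileCell_le (hH : ∀ j c, PT {t | t j = c} = 0)
    (hM : IsLimitContent 𝒰 F M) {K : ℕ} (hK : 0 < K) :
    ∑ p : Fin q × Fin (K + 1), M (quantileCell (PT.map fun t => t p.1) K p.2) *
      (PT.map fun t => t p.1).real (quantileCell (PT.map fun t => t p.1) K p.2) ≤ q / K := by
  rw [Fintype.sum_prod_type]
  have h : ∀ j : Fin q, ∑ k : Fin (K + 1), M (quantileCell (PT.map fun t => t j) K k) *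
      (PT.map fun t => t j).real (quantileCell (PT.map fun t => t j) K k) ≤ 1 / K := by
    intro j
    have hm : Measurable fun t : Fin q → ℝ => t j := measurable_pi_apply j
    have : IsProbabilityMeasure (PT.map fun t => t j) :=
      Measure.isProbabilityMeasure_map hm.aemeasurable
    have : NullSingletonClass (PT.map fun t => t j) := ⟨fun c => by
      rw [Measure.map_apply hm (measurableSet_singleton c)]
      exact hH j c⟩
    calc ∑ k : Fin (K + 1), M (quantileCell (PT.map fun t => t j) K k) *
          (PT.map fun t => t j).real (quantileCell (PT.map fun t => t j) K k)
        ≤ ∑ k : Fin (K + 1), M (quantileCell (PT.map fun t => t j) K k) * (1 / K) :=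
          Finset.sum_le_sum fun k _ =>
            mul_le_mul_of_nonneg_left (real_quantileCell_le _ hK k) (hM.nonneg _)
      _ = 1 / K := by
          rw [← Finset.sum_mul, hM.sum_eq_one _ fun n => sum_real_quantileCell _ _ K, one_mul]
  refine (Finset.sum_le_sum fun j _ => h j).trans_eq ?_
  rw [Finset.sum_const, Finset.card_univ, Fintype.card_fin, nsmul_eq_mul]
  ring

theorem integral_inv_mul_sq_le (hH : ∀ j c, PT {t | t j = c} = 0) (hR : Monotonicity R)
    (h𝒰 : 𝒰 ≤ atTop) (hM : IsLimitContent 𝒰 F M) {T : ℕ → Fin q → ℝ} {Y : ℕ → ℝ}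
    {K : ℕ} (hK : 0 < K)
    (hscore : ∀ p, Tendsto (fun n : ℕ =>
      (∑ j ∈ Finset.range n, cellScore R PT PY K p (T j, Y j)) / n) atTop
      (𝓝 (∫ x, cellScore R PT PY K p x ∂(PT.prod PY))))
    (hocc : ∀ p : Fin q × Fin (K + 1), Tendsto (fun n : ℕ => (∑ j ∈ Finset.range n,
      (quantileCell (PT.map fun t => t p.1) K p.2).indicator 1 (T j p.1)) / (n : ℝ)) atTop
      (𝓝 ((PT.map fun t => t p.1).real (quantileCell (PT.map fun t => t p.1) K p.2))))
    {l : ℕ → Fin m} (hl : ∀ j, Y j ∈ R.range (T j) (l j))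
    (hopt : ∀ n, 1 ≤ n → (∀ j < n, 0 < (F n : Measure ℝ).real (R.range (T j) (l j))) ∧
      ∑ j ∈ Finset.range n, PY.real (R.range (T j) (l j)) /
        (F n : Measure ℝ).real (R.range (T j) (l j)) ≤ n)
    {δ : ℝ} (hδ : 0 < δ) :
    ∫ t, ∑ i, (M (R.range (cellPoint PT K (cellIndex PT K t)) i) + δ)⁻¹ *
      PY.real (R.range t i) ^ 2 ∂PT ≤ 1 + (δ ^ 2)⁻¹ * (q / K) := by
  have hlim : Tendsto (fun n : ℕ =>
      ∑ p : (Fin q → Fin (K + 1)) × Fin m,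
        ((F n : Measure ℝ).real (R.range (cellPoint PT K p.1) p.2) + δ)⁻¹ *
          ((∑ j ∈ Finset.range n, cellScore R PT PY K p (T j, Y j)) / n) -
      (δ ^ 2)⁻¹ * ∑ p : Fin q × Fin (K + 1),
        (F n : Measure ℝ).real (quantileCell (PT.map fun t => t p.1) K p.2) *
          ((∑ j ∈ Finset.range n,
            (quantileCell (PT.map fun t => t p.1) K p.2).indicator 1 (T j p.1)) / (n : ℝ))) 𝒰
      (𝓝 (∑ p : (Fin q → Fin (K + 1)) × Fin m, (M (R.range (cellPoint PT K p.1) p.2) + δ)⁻¹ *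
          ∫ x, cellScore R PT PY K p x ∂(PT.prod PY) -
        (δ ^ 2)⁻¹ * ∑ p : Fin q × Fin (K + 1), M (quantileCell (PT.map fun t => t p.1) K p.2) *
          (PT.map fun t => t p.1).real (quantileCell (PT.map fun t => t p.1) K p.2))) := by
    refine Tendsto.sub (tendsto_finsetSum _ fun p _ => ?_)
      ((tendsto_finsetSum _ fun p _ => ?_).const_mul _)
    · refine Tendsto.mul (((hM _).add_const δ).inv₀ ?_) ((hscore p).mono_left h𝒰)
      have := hM.nonneg (R.range (cellPoint PT K p.1) p.2)
      positivity
    · exact (hM _).mul ((hocc p).mono_left h𝒰)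
  have hle := le_of_tendsto (b := 1) hlim ?_
  · rw [integral_sum_mul_cellScore hR PT PY K
      fun p => (M (R.range (cellPoint PT K p.1) p.2) + δ)⁻¹] at hle
    have h1 := sum_mul_real_quantileCell_le hH hM hK
    have h2 : 0 ≤ (δ ^ 2)⁻¹ := by positivity
    have h3 := mul_le_mul_of_nonneg_left h1 h2
    linarith
  -- For each `n ≥ 1` the cell-constant average is at most the average ratio, which optimality
  -- bounds by 1.
  · filter_upwards [h𝒰 (eventually_ge_atTop 1)] with n hn
    obtain ⟨hpos, hsum⟩ := hopt n hn
    rw [sum_mul_average, sum_mul_average, ← mul_div_assoc, ← sub_div,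
      div_le_one (Nat.cast_pos.2 hn), Finset.mul_sum, ← Finset.sum_sub_distrib]
    refine le_trans (Finset.sum_le_sum fun j hj => ?_) hsum
    have h1 := cellPoint_score_le hR PT PY (F n : Measure ℝ) K hδ (T j) (l j)
      (hpos j (Finset.mem_range.1 hj))
    rw [sum_mul_cellScore R PT PY K _ (hl j)]
    have h2 := sum_prod_mul_indicator_quantileCell PT K (fun j' k =>
      (F n : Measure ℝ).real (quantileCell (PT.map fun t => t j') K k)) (T j)
    rw [h2]
    exact h1

end Limit

/-! ### From the chi-square bound to equality almost everywhere -/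

/-- With `y = x + δ ≤ 2`, one has `(p - y)² = y (p² / y - 2p + y)`. The bracketed terms are
nonnegative, so each is at most their sum. -/
theorem sum_sq_le {ι : Type*} [Fintype ι] {p x : ι → ℝ} (hp : ∑ i, p i = 1) (hx : ∑ i, x i = 1)
    (hx0 : ∀ i, 0 ≤ x i) (hx1 : ∀ i, x i ≤ 1) {δ : ℝ} (hδ : 0 < δ) (hδ1 : δ ≤ 1) (i : ι) :
    (p i - x i - δ) ^ 2 ≤ 2 * (∑ i, (x i + δ)⁻¹ * p i ^ 2 - 1 + Fintype.card ι * δ) := by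
  have hpt : ∀ i, (p i - x i - δ) ^ 2 =
      (x i + δ) * ((x i + δ)⁻¹ * p i ^ 2 - 2 * p i + (x i + δ)) := by
    intro i
    have : x i + δ ≠ 0 := by have := hx0 i; positivity
    field_simp
    ring
  have hnn : ∀ i, 0 ≤ (x i + δ)⁻¹ * p i ^ 2 - 2 * p i + (x i + δ) := by
    intro i
    have h1 : 0 < x i + δ := by have := hx0 i; positivity
    exact nonneg_of_mul_nonneg_right ((sq_nonneg _).trans_eq (hpt i)) h1
  have hsum : ∑ i, ((x i + δ)⁻¹ * p i ^ 2 - 2 * p i + (x i + δ)) =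
      ∑ i, (x i + δ)⁻¹ * p i ^ 2 - 1 + Fintype.card ι * δ := by
    rw [Finset.sum_add_distrib, Finset.sum_sub_distrib, ← Finset.mul_sum, hp,
      Finset.sum_add_distrib, hx, Finset.sum_const, Finset.card_univ, nsmul_eq_mul]
    ring
  rw [hpt, ← hsum]
  exact mul_le_mul (by linarith [hx1 i])
    (Finset.single_le_sum (fun i _ => hnn i) (Finset.mem_univ i)) (hnn i) (by norm_num)

/-- A function dominated by nonnegative integrable functions of arbitrarily small integral vanishes
almost everywhere. -/
theorem ae_eq_zero_of_le_integral_le {α : Type*} [MeasurableSpace α] {μ : Measure α} {f : α → ℝ}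
    {g : ℕ → α → ℝ} (hg : ∀ r, Measurable (g r)) (hint : ∀ r, Integrable (g r) μ)
    (hf : ∀ x, 0 ≤ f x) (hfg : ∀ r x, f x ≤ g r x) {C : ℝ}
    (hC : ∀ r : ℕ, ∫ x, g r x ∂μ ≤ C / (r + 1)) : ∀ᵐ x ∂μ, f x = 0 := by
  -- The infimum of the majorants is measurable, which is not assumed of `f`.
  have h1 : ∫⁻ x, ⨅ r, ENNReal.ofReal (g r x) ∂μ = 0 := by
    have h2 : ∀ r : ℕ, ∫⁻ x, ⨅ r, ENNReal.ofReal (g r x) ∂μ ≤ ENNReal.ofReal (C / (r + 1)) := by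
      intro r
      calc ∫⁻ x, ⨅ r, ENNReal.ofReal (g r x) ∂μ ≤ ∫⁻ x, ENNReal.ofReal (g r x) ∂μ :=
            lintegral_mono fun x => iInf_le _ r
        _ = ENNReal.ofReal (∫ x, g r x ∂μ) :=
            (ofReal_integral_eq_lintegral_ofReal (hint r)
              (Eventually.of_forall fun x => (hf x).trans (hfg r x))).symm
        _ ≤ _ := ENNReal.ofReal_le_ofReal (hC r)
    have h3 : Tendsto (fun r : ℕ => ENNReal.ofReal (C / (r + 1))) atTop (𝓝 0) := by
      have h4 : Tendsto (fun r : ℕ => C * (1 / ((r : ℝ) + 1))) atTop (𝓝 (C * 0)) :=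
        tendsto_one_div_add_atTop_nhds_zero_nat.const_mul C
      have h5 := ENNReal.tendsto_ofReal h4
      simpa [div_eq_mul_inv] using h5
    exact le_antisymm (ge_of_tendsto' h3 h2) zero_le
  rw [lintegral_eq_zero_iff (Measurable.iInf fun r => (hg r).ennreal_ofReal)] at h1
  filter_upwards [h1] with x hx
  refine le_antisymm ?_ (hf x)
  rw [← ENNReal.ofReal_eq_zero, ← nonpos_iff_eq_zero]
  exact (le_iInf fun r => ENNReal.ofReal_le_ofReal (hfg r x)).trans_eq hx

theorem measurable_comp_cellIndex (PT : Measure (Fin q → ℝ)) {K : ℕ} (f : (Fin q → Fin (K + 1)) → ℝ) :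
    Measurable fun t => f (cellIndex PT K t) :=
  (measurable_of_finite f).comp (measurable_cellIndex PT K)

/-- Cauchy–Schwarz for `a - b = (a - c) - (b - c - d) - d`. -/
theorem sub_sq_le (a b c d : ℝ) :
    (a - b) ^ 2 ≤ 3 * (a - c) ^ 2 + 3 * (b - c - d) ^ 2 + 3 * d ^ 2 := by
  nlinarith [sq_nonneg ((a - c) + (b - c - d)), sq_nonneg ((a - c) + d),
    sq_nonneg ((b - c - d) - d)]

section Limit

variable {R : RangeMap q m} {PT : Measure (Fin q → ℝ)} [IsProbabilityMeasure PT]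
  {PY : Measure ℝ} [IsProbabilityMeasure PY] {𝒰 : Filter ℕ} [𝒰.NeBot]
  {F : ℕ → ProbabilityMeasure ℝ} {M : Set ℝ → ℝ}

theorem integral_sum_quantileCell_le (hH : ∀ j c, PT {t | t j = c} = 0)
    (hM : IsLimitContent 𝒰 F M) {K : ℕ} (hK : 0 < K) :
    ∫ t, ∑ j, M (quantileCell (PT.map fun t => t j) K (cellIndex PT K t j)) ∂PT ≤ q / K := by
  refine le_trans (le_of_eq ?_) (sum_mul_real_quantileCell_le hH hM hK)
  have h1 : ∀ t, ∑ j, M (quantileCell (PT.map fun t => t j) K (cellIndex PT K t j)) =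
      ∑ p : Fin q × Fin (K + 1), M (quantileCell (PT.map fun t => t p.1) K p.2) *
        ((fun t : Fin q → ℝ => t p.1) ⁻¹'
          (quantileCell (PT.map fun t => t p.1) K p.2)).indicator 1 t := by
    intro t
    have hpre : ∀ (j : Fin q) (A : Set ℝ), ((fun t : Fin q → ℝ => t j) ⁻¹' A).indicator
        (1 : (Fin q → ℝ) → ℝ) t = A.indicator 1 (t j) := fun _ _ => rfl
    simp_rw [hpre]
    have h := sum_prod_mul_indicator_quantileCell PT K
      (fun j k => M (quantileCell (PT.map fun t => t j) K k)) t
    rw [← h]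
  have hms : ∀ p : Fin q × Fin (K + 1), MeasurableSet ((fun t : Fin q → ℝ => t p.1) ⁻¹'
      (quantileCell (PT.map fun t => t p.1) K p.2)) := fun p =>
    measurable_pi_apply p.1 (measurableSet_quantileCell _ K p.2)
  have hI : ∀ p : Fin q × Fin (K + 1), Integrable (((fun t : Fin q → ℝ => t p.1) ⁻¹'
      (quantileCell (PT.map fun t => t p.1) K p.2)).indicator (1 : (Fin q → ℝ) → ℝ)) PT := fun p =>
    (integrable_const (1 : ℝ)).indicator (hms p)
  simp_rw [h1]
  rw [integral_finsetSum _ fun p _ => (hI p).const_mul _]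
  refine Finset.sum_congr rfl fun p _ => ?_
  rw [integral_const_mul, integral_indicator_one (hms p),
    map_measureReal_apply (measurable_pi_apply p.1) (measurableSet_quantileCell _ K p.2)]

/-- A majorant is needed because `t ↦ M(R_t^(i))`, a limit along a filter, is not known to be
measurable; functions of the cell index are. -/
theorem exists_majorant_sq_sub (hH : ∀ j c, PT {t | t j = c} = 0) (hR : Monotonicity R)
    (hM : IsLimitContent 𝒰 F M) {K : ℕ} (hK : 0 < K) {δ : ℝ} (hδ : 0 < δ) (hδ1 : δ ≤ 1)
    (hS : ∫ t, ∑ i, (M (R.range (cellPoint PT K (cellIndex PT K t)) i) + δ)⁻¹ *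
      PY.real (R.range t i) ^ 2 ∂PT ≤ 1 + (δ ^ 2)⁻¹ * (q / K)) (i : Fin m) :
    ∃ g : (Fin q → ℝ) → ℝ, Measurable g ∧ Integrable g PT ∧
      (∀ t, (M (R.range t i) - PY.real (R.range t i)) ^ 2 ≤ g t) ∧
      ∫ t, g t ∂PT ≤ 6 * ((δ ^ 2)⁻¹ * (q / K) + m * δ) + 3 * δ ^ 2 + 3 * q * (q / K) := by
  obtain ⟨x, hx⟩ : ∃ x : (Fin q → Fin (K + 1)) → Fin m → ℝ,
      ∀ κ k, x κ k = M (R.range (cellPoint PT K κ) k) := ⟨_, fun _ _ => rfl⟩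
  obtain ⟨w, hw⟩ : ∃ w : (Fin q → Fin (K + 1)) → ℝ,
      ∀ κ, w κ = ∑ j, M (quantileCell (PT.map fun t => t j) K (κ j)) := ⟨_, fun _ => rfl⟩
  have hx0 : ∀ κ k, 0 ≤ x κ k := fun κ k => by rw [hx]; exact hM.nonneg _
  have hx1 : ∀ κ k, x κ k ≤ 1 := fun κ k => by rw [hx]; exact hM.le_one _
  have hxsum : ∀ κ, ∑ k, x κ k = 1 := fun κ => by
    simp_rw [hx]
    exact hM.sum_eq_one _ fun n => R.sum_real_range (F n : Measure ℝ) (cellPoint PT K κ)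
  have hw0 : ∀ κ, 0 ≤ w κ := fun κ => by
    rw [hw]
    exact Finset.sum_nonneg fun j _ => hM.nonneg _
  have hwq : ∀ κ, w κ ≤ q := fun κ => by
    rw [hw]
    refine (Finset.sum_le_sum fun j _ => hM.le_one _).trans_eq ?_
    simp
  have hWint : ∫ t, w (cellIndex PT K t) ∂PT ≤ q / K := by
    simp_rw [hw]
    exact integral_sum_quantileCell_le hH hM hK
  simp_rw [← hx] at hS
  have hdiff : ∀ t, |M (R.range t i) - x (cellIndex PT K t) i| ≤ w (cellIndex PT K t) := by
    intro t
    rw [hw, hx]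
    exact (hM.abs_sub_le hR _ _ i).trans
      (Finset.sum_le_sum fun j _ => hM.mono (uIoc_cellPoint_subset PT K t j))
  clear hx hw
  have hSm : ∀ k, Measurable fun t => (x (cellIndex PT K t) k + δ)⁻¹ * PY.real (R.range t k) ^ 2 :=
    fun k => (measurable_comp_cellIndex PT fun κ => (x κ k + δ)⁻¹).mul
      ((hR.measurable_real_range PY k).pow_const 2)
  have hSi : ∀ k, Integrable
      (fun t => (x (cellIndex PT K t) k + δ)⁻¹ * PY.real (R.range t k) ^ 2) PT := fun k => by
    refine Integrable.of_bound (hSm k).aestronglyMeasurable δ⁻¹ (Eventually.of_forall fun t => ?_)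
    have h0 := hx0 (cellIndex PT K t) k
    have h2 : 0 ≤ PY.real (R.range t k) := measureReal_nonneg
    rw [Real.norm_of_nonneg (by positivity)]
    exact (mul_le_of_le_one_right (by positivity)
      (pow_le_one₀ h2 measureReal_le_one)).trans (inv_anti₀ hδ (by linarith))
  have hWm : Measurable fun t => w (cellIndex PT K t) := measurable_comp_cellIndex PT w
  have hWi : Integrable (fun t => w (cellIndex PT K t)) PT :=
    Integrable.of_bound hWm.aestronglyMeasurable q (Eventually.of_forall fun t => by
      rw [Real.norm_of_nonneg (hw0 _)]
      exact hwq _)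
  obtain ⟨S, hSdef⟩ : ∃ S : (Fin q → ℝ) → ℝ, S = fun t =>
    ∑ k, (x (cellIndex PT K t) k + δ)⁻¹ * PY.real (R.range t k) ^ 2 := ⟨_, rfl⟩
  have hSmeas : Measurable S := hSdef ▸ Finset.measurable_sum _ fun k _ => hSm k
  have hSint : Integrable S PT := hSdef ▸ integrable_finsetSum _ fun k _ => hSi k
  have hSle : ∫ t, S t ∂PT ≤ 1 + (δ ^ 2)⁻¹ * (q / K) := by rwa [hSdef]
  have hsum : Integrable (fun t => 6 * S t + 3 * q * w (cellIndex PT K t)) PT :=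
    (hSint.const_mul 6).add (hWi.const_mul (3 * q))
  -- By `sub_sq_le`, three times the discretization error (at most `q * w`), three times the bound
  -- of `sum_sq_le`, and `3 * δ ^ 2`.
  refine ⟨fun t => 6 * S t + 3 * q * w (cellIndex PT K t) + (6 * (m * δ - 1) + 3 * δ ^ 2),
    ((hSmeas.const_mul 6).add (hWm.const_mul (3 * q))).add_const _,
    hsum.add (integrable_const _), fun t => ?_, ?_⟩
  · have h1 := sum_sq_le (R.sum_real_range PY t) (hxsum (cellIndex PT K t)) (hx0 _) (hx1 _) hδ hδ1 i
    have h2 := hdiff t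
    have h3 : (M (R.range t i) - x (cellIndex PT K t) i) ^ 2 ≤ q * w (cellIndex PT K t) := by
      rw [← sq_abs, sq]
      exact mul_le_mul (h2.trans (hwq _)) h2 (abs_nonneg _) (Nat.cast_nonneg q)
    have h4 := sub_sq_le (M (R.range t i)) (PY.real (R.range t i)) (x (cellIndex PT K t) i) δ
    have h5 : S t = ∑ k, (x (cellIndex PT K t) k + δ)⁻¹ * PY.real (R.range t k) ^ 2 := by
      rw [hSdef]
    rw [Fintype.card_fin, ← h5] at h1
    linarith
  · beta_reduce
    rw [integral_add hsum (integrable_const _), integral_add (hSint.const_mul 6) (hWi.const_mul (3 * q)),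
      integral_const_mul, integral_const_mul, integral_const, probReal_univ, one_smul]
    have h1 : 3 * (q : ℝ) * ∫ t, w (cellIndex PT K t) ∂PT ≤ 3 * q * (q / K) :=
      mul_le_mul_of_nonneg_left hWint (by positivity)
    linarith

theorem majorant_bound_le (a b r : ℝ) (ha : 0 ≤ a) (hr : 1 ≤ r) :
    6 * (((1 / r) ^ 2)⁻¹ * (a / r ^ 3) + b * (1 / r)) + 3 * (1 / r) ^ 2 + 3 * a * (a / r ^ 3) ≤
      (6 * (a + b) + 3 + 3 * a ^ 2) / r := by
  have hr0 : 0 < r := by linarith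
  have h1 : (1 / r) ^ 2 ≤ 1 / r := by
    rw [div_pow, one_pow]
    exact one_div_le_one_div_of_le hr0 (by nlinarith)
  have h2 : a / r ^ 3 ≤ a / r := by
    refine div_le_div_of_nonneg_left ha hr0 ?_
    nlinarith [mul_nonneg (sub_nonneg.2 hr) hr0.le, mul_nonneg (sub_nonneg.2 hr) (sq_nonneg r)]
  have h3 : ((1 / r) ^ 2)⁻¹ * (a / r ^ 3) = a / r := by field_simp
  have h4 : (6 * (a + b) + 3 + 3 * a ^ 2) / r =
      6 * (a / r + b * (1 / r)) + 3 * (1 / r) + 3 * a * (a / r) := by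
    field_simp
  rw [h3, h4]
  have h5 := mul_le_mul_of_nonneg_left h2 (by positivity : 0 ≤ 3 * a)
  linarith

theorem limit_range_ae_eq (hH : ∀ j c, PT {t | t j = c} = 0) (hR : Monotonicity R)
    (h𝒰 : 𝒰 ≤ atTop) (hM : IsLimitContent 𝒰 F M) {T : ℕ → Fin q → ℝ} {Y : ℕ → ℝ}
    (hscore : ∀ K p, Tendsto (fun n : ℕ =>
      (∑ j ∈ Finset.range n, cellScore R PT PY K p (T j, Y j)) / n) atTop
      (𝓝 (∫ x, cellScore R PT PY K p x ∂(PT.prod PY))))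
    (hocc : ∀ (K : ℕ) (p : Fin q × Fin (K + 1)), Tendsto (fun n : ℕ => (∑ j ∈ Finset.range n,
      (quantileCell (PT.map fun t => t p.1) K p.2).indicator 1 (T j p.1)) / (n : ℝ)) atTop
      (𝓝 ((PT.map fun t => t p.1).real (quantileCell (PT.map fun t => t p.1) K p.2))))
    {l : ℕ → Fin m} (hl : ∀ j, Y j ∈ R.range (T j) (l j))
    (hopt : ∀ n, 1 ≤ n → (∀ j < n, 0 < (F n : Measure ℝ).real (R.range (T j) (l j))) ∧
      ∑ j ∈ Finset.range n, PY.real (R.range (T j) (l j)) /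
        (F n : Measure ℝ).real (R.range (T j) (l j)) ≤ n) (i : Fin m) :
    ∀ᵐ t ∂PT, M (R.range t i) = PY.real (R.range t i) := by
  -- With `δ = 1 / (r + 1)`, a cubic `K` makes both `δ⁻² q / K` and `m δ` of order `1 / (r + 1)`.
  obtain ⟨K, hK⟩ : ∃ K : ℕ → ℕ, ∀ r, K r = (r + 1) ^ 3 := ⟨_, fun _ => rfl⟩
  have hK0 : ∀ r, 0 < K r := fun r => by rw [hK]; positivity
  have hr1 : ∀ r : ℕ, 1 ≤ (r : ℝ) + 1 := fun r => le_add_of_nonneg_left (Nat.cast_nonneg r)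
  have hδ : ∀ r : ℕ, 0 < 1 / ((r : ℝ) + 1) := fun r => by positivity
  have hδ1 : ∀ r : ℕ, 1 / ((r : ℝ) + 1) ≤ 1 := fun r =>
    (div_le_one (by positivity)).2 (hr1 r)
  choose g hgm hgi hg hgint using fun r => exists_majorant_sq_sub hH hR hM (hK0 r) (hδ r) (hδ1 r)
    (integral_inv_mul_sq_le (PY := PY) hH hR h𝒰 hM (hK0 r) (hscore (K r)) (hocc (K r)) hl hopt
      (hδ r)) i
  have hae := ae_eq_zero_of_le_integral_le (μ := PT) hgm hgi (fun t => sq_nonneg _) hg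
    (C := 6 * (q + m) + 3 + 3 * (q : ℝ) ^ 2) fun r => by
      refine (hgint r).trans ?_
      rw [hK]
      push_cast
      exact majorant_bound_le q m (r + 1) (Nat.cast_nonneg q) (hr1 r)
  filter_upwards [hae] with t ht
  exact sub_eq_zero.1 ((pow_eq_zero_iff two_ne_zero).1 ht)

end Limit

/-! ### Almost sure inputs -/

theorem ae_tendsto_average {α Ω : Type*} [MeasurableSpace α] [MeasurableSpace Ω] {P : Measure Ω}
    [IsProbabilityMeasure P] {μ : Measure α} {X : ℕ → Ω → α} (hX : ∀ j, HasLaw (X j) μ P)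
    (hindep : iIndepFun X P) {φ : α → ℝ} (hφ : Measurable φ) {C : ℝ} (hC : ∀ x, |φ x| ≤ C) :
    ∀ᵐ ω ∂P, Tendsto (fun n : ℕ => (∑ j ∈ Finset.range n, φ (X j ω)) / n) atTop
      (𝓝 (∫ x, φ x ∂μ)) := by
  have h := strong_law_ae_real (μ := P) (fun j ω => φ (X j ω))
    (Integrable.of_bound (hφ.comp_aemeasurable (hX 0).aemeasurable).aestronglyMeasurable C
      (Eventually.of_forall fun ω => hC _))
    (fun i j hij => (hindep.indepFun hij).comp hφ hφ)
    (fun j => (⟨(hX j).aemeasurable, (hX 0).aemeasurable, by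
      rw [(hX j).map_eq, (hX 0).map_eq]⟩ : IdentDistrib (X j) (X 0) P P).comp hφ)
  have h2 : ∫ ω, φ (X 0 ω) ∂P = ∫ x, φ x ∂μ := by
    rw [← (hX 0).map_eq, integral_map (hX 0).aemeasurable hφ.aestronglyMeasurable]
  rwa [h2] at h

/-- By Fubini: for fixed `t`, a range of `F_Y`-mass zero is hit with probability zero. This makes
`F_Y` an admissible competitor in the optimality condition. -/
theorem ae_prod_real_range_pos {R : RangeMap q m} (hR : Monotonicity R)
    (PT : Measure (Fin q → ℝ)) (PY : Measure ℝ) [IsProbabilityMeasure PY] (i : Fin m) :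
    ∀ᵐ x ∂(PT.prod PY), x.2 ∈ R.range x.1 i → 0 < PY.real (R.range x.1 i) := by
  have hms : MeasurableSet ({x : (Fin q → ℝ) × ℝ | x.2 ∈ R.range x.1 i} ∩
      {x | PY.real (R.range x.1 i) = 0}) :=
    (hR.measurableSet_mem_range i).inter
      (((hR.measurable_real_range PY i).comp measurable_fst) (measurableSet_singleton 0))
  have h := (Measure.measure_prod_null (μ := PT) (ν := PY) hms).2 (Eventually.of_forall fun t => by
    by_cases h0 : PY.real (R.range t i) = 0
    · exact measure_mono_null (fun y hy => hy.1) ((measureReal_eq_zero_iff).1 h0)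
    · exact measure_mono_null (t := ∅) (fun y hy => h0 hy.2) measure_empty)
  refine measure_mono_null (fun x hx => ?_) h
  simp only [Set.mem_compl_iff, Set.mem_ofPred_eq, Classical.not_imp, not_lt] at hx
  exact ⟨hx.1, le_antisymm hx.2 measureReal_nonneg⟩

theorem Resolvability.measure_hyperplane {𝒴 : Set ℝ} {R : RangeMap q m}
    {PT : Measure (Fin q → ℝ)} (h : Resolvability 𝒴 R PT) (j : Fin q) (c : ℝ) :
    PT {t | t j = c} = 0 := by
  obtain ⟨⟨p, -, rfl⟩, -⟩ := h
  refine withDensity_absolutelyContinuous _ _ ?_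
  rw [volume_pi]
  exact Measure.pi_hyperplane (fun _ : Fin q => (volume : Measure ℝ)) j c

end RangePrivacy

open RangePrivacy in
theorem mainTheorem3 {q m : ℕ} {Ω : Type*} [MeasurableSpace Ω]
    (P : Measure Ω) [IsProbabilityMeasure P]
    (R : RangePrivacy.RangeMap q m) (𝒴 : Set ℝ)
    (PT : Measure (Fin q → ℝ)) [IsProbabilityMeasure PT]
    (PY : Measure ℝ) [IsProbabilityMeasure PY]
    (T : ℕ → Ω → Fin q → ℝ) (Y : ℕ → Ω → ℝ)
    (hT : ∀ j, HasLaw (T j) PT P) (hY : ∀ j, HasLaw (Y j) PY P)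
    (hTY : ∀ j, IndepFun (T j) (Y j) P)
    (hindep : iIndepFun (fun j ω => (T j ω, Y j ω)) P)
    (h𝒴 : ∀ᵐ y ∂PY, y ∈ 𝒴)
    (hcont : Continuous (cdf PY))
    (hres : RangePrivacy.Resolvability 𝒴 R PT)
    (hmono : RangePrivacy.Monotonicity R)
    (Fhat : ℕ → Ω → ProbabilityMeasure ℝ)
    (hFhat : ∀ n, 1 ≤ n → ∀ᵐ ω ∂P,
      RangePrivacy.IsNPMLE 𝒴 R (fun j : Fin n => T j ω) (fun j : Fin n => Y j ω) (Fhat n ω)) :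
    ∀ᵐ ω ∂P, Tendsto
      (fun n => ⨆ y : 𝒴, |cdf (Fhat n ω : Measure ℝ) (y : ℝ) - cdf PY (y : ℝ)|) atTop (𝓝 0) := by
  have hlaw : ∀ j, HasLaw (fun ω => (T j ω, Y j ω)) (PT.prod PY) P := fun j =>
    ⟨(hT j).aemeasurable.prodMk (hY j).aemeasurable, by
      rw [(indepFun_iff_map_prod_eq_prod_map_map (hT j).aemeasurable (hY j).aemeasurable).1 (hTY j),
        (hT j).map_eq, (hY j).map_eq]⟩
  have hopt : ∀ᵐ ω ∂P, ∀ n, 1 ≤ n →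
      IsNPMLE 𝒴 R (fun j : Fin n => T j ω) (fun j : Fin n => Y j ω) (Fhat n ω) := by
    rw [ae_all_iff]
    intro n
    by_cases hn : 1 ≤ n
    · filter_upwards [hFhat n hn] with ω h _ using h
    · exact Eventually.of_forall fun ω h => absurd h hn
  have hpos : ∀ᵐ ω ∂P, ∀ j i, Y j ω ∈ R.range (T j ω) i → 0 < PY.real (R.range (T j ω) i) := by
    rw [ae_all_iff]
    intro j
    rw [ae_all_iff]
    intro i
    have h := ae_prod_real_range_pos hmono PT PY i
    rw [← (hlaw j).map_eq] at h
    exact ae_of_ae_map (hlaw j).aemeasurable h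
  have hscore : ∀ᵐ ω ∂P, ∀ K p, Tendsto (fun n : ℕ =>
      (∑ j ∈ Finset.range n, cellScore R PT PY K p (T j ω, Y j ω)) / n) atTop
      (𝓝 (∫ x, cellScore R PT PY K p x ∂(PT.prod PY))) := by
    rw [ae_all_iff]
    intro K
    rw [ae_all_iff]
    intro p
    exact ae_tendsto_average hlaw hindep (measurable_cellScore hmono PT PY K p)
      (abs_cellScore_le R PT PY K p)
  have hocc : ∀ᵐ ω ∂P, ∀ (K : ℕ) (p : Fin q × Fin (K + 1)), Tendsto (fun n : ℕ =>
      (∑ j ∈ Finset.range n,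
        (quantileCell (PT.map fun t => t p.1) K p.2).indicator 1 (T j ω p.1)) / (n : ℝ)) atTop
      (𝓝 ((PT.map fun t => t p.1).real (quantileCell (PT.map fun t => t p.1) K p.2))) := by
    rw [ae_all_iff]
    intro K
    rw [ae_all_iff]
    intro p
    have hms := measurableSet_quantileCell (PT.map fun t : Fin q → ℝ => t p.1) K p.2
    have hm : Measurable fun t : Fin q → ℝ => t p.1 := measurable_pi_apply p.1
    have hindT : iIndepFun T P := hindep.comp (fun _ => Prod.fst) fun _ => measurable_fst
    have h := ae_tendsto_average hT hindT
      (φ := (((fun t : Fin q → ℝ => t p.1) ⁻¹'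
        quantileCell (PT.map fun t : Fin q → ℝ => t p.1) K p.2).indicator 1))
      (measurable_one.indicator (hm hms)) (C := 1) (fun t => by
        by_cases ht : t ∈ (fun t : Fin q → ℝ => t p.1) ⁻¹'
          quantileCell (PT.map fun t : Fin q → ℝ => t p.1) K p.2 <;> simp [ht])
    rw [integral_indicator_one (hm hms), ← map_measureReal_apply hm hms] at h
    exact h
  filter_upwards [hopt, hpos, hscore, hocc] with ω hopt hpos hscore hocc
  refine tendsto_iSup_abs_cdf_sub hcont (fun x => ?_) 𝒴
  -- Along an ultrafilter all set masses converge at once, so it remains to identify the limit.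
  rw [tendsto_iff_ultrafilter]
  intro 𝒰 h𝒰
  obtain ⟨M, hM⟩ := exists_isLimitContent 𝒰 fun n => Fhat n ω
  choose l hl _ using fun j => R.existsUnique_mem_range (T j ω) (Y j ω)
  have hopt' : ∀ n, 1 ≤ n →
      (∀ j < n, 0 < (Fhat n ω : Measure ℝ).real (R.range (T j ω) (l j))) ∧
      ∑ j ∈ Finset.range n, PY.real (R.range (T j ω) (l j)) /
        (Fhat n ω : Measure ℝ).real (R.range (T j ω) (l j)) ≤ n := by
    intro n hn
    have h := (hopt n hn).sum_div_le (F := ⟨PY, inferInstance⟩) h𝒴 (fun j => l j)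
      (fun j => hl j) (fun j => hpos j _ (hl j))
    exact ⟨fun j hj => h.1 ⟨j, hj⟩, (Finset.sum_range _).trans_le h.2⟩
  have hae := limit_range_ae_eq hres.measure_hyperplane hmono h𝒰 hM hscore hocc hl hopt'
  rw [← limit_Iic_eq_cdf hres.measure_hyperplane hres hmono hcont h𝒴 hM hae x]
  simp only [cdf_eq_real]
  exact hM _
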